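/- All hypergraphs $H=(V,E)$ are finite, simple (no edge is contained in another edge and $|e|\ge 2$ for all $e\in E\subseteq 2^V$) and connected. Let $r=\max_{e\in E}|e|$ be the rank of $H$ ($r=0$ if $E=\emptyset$), let $N[v]$ be the set consisting of $v$ and all vertices that share an edge with $v$, and let the $2$-section $[H]_2$ be the graph on $V$ whose edges are the pairs $\{x,y\}$, $x\ne y$, that are contained in some $e\in E$. An edge $e$ of $H$ is dispensable in $H$ if there are a vertex $z\in V$ and distinct $x,y\in e$ such that (1) $N[x]\cap N[y]\subsetneq N[x]\cap N[z]$ or $N[x]\subsetneq N[z]\subsetneq N[y]$, and (2) $N[x]\cap N[y]\subsetneq N[y]\cap N[z]$ or $N[y]\subsetneq N[z]\subsetneq N[x]$. Let $D(H)\subseteq E$ be the set of dispensable edges of $H$. The Cartesian skeleton of $H$ is the hypergraph $(V,E\setminus D(H))$. Consider the following algorithm, whose input is the number of vertices and a list of the edges of $H$, each given as a list of its vertices: first compute the set $D([H]_2)$ of dispensable edges of the $2$-section, as follows: tabulate the adjacencies and the closed neighbourhoods of $[H]_2$, and test conditions (1) and (2) for every edge $\{x,y\}$ of $[H]_2$ and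 every vertex $z$ by counting the elements of $N[x]$, $N[y]$, $N[z]$ and of their intersections, where the elements of $N[z]$ are run through for each $z$; then, for every $\{x,y\}\in D([H]_2)$, remove all edges $e$ with $x,y\in e$ from $E$; the output is what remains of $(V,E)$. Then the first step computes $D([H]_2)$ correctly, the output of the algorithm is the Cartesian skeleton of $H$, and on a random access machine with unit costs the algorithm takes $O(|E|^2r^4)$ steps: there is an absolute constant $C$ such that for every $H$, every numbering of its vertices and every listing of its edges the number of steps is at most $C\cdot\max\{1,|E|^2r^4\}$. (The maximum matters only if $E=\emptyset$, that is, $|V|\le 1$.) -/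

import Mathlib

/-! ### Hypergraphs -/

namespace Hypergraph

/-- No edge is contained in another edge, and every edge has at least two vertices. -/
def IsSimple {α : Type*} (H : Hypergraph α) : Prop :=
  (∀ e ∈ H.edgeSet, ∀ f ∈ H.edgeSet, e ⊆ f → e = f) ∧ ∀ e ∈ H.edgeSet, 2 ≤ e.ncard

/-- Any two vertices are joined by a chain of edges. -/
def IsConnected {α : Type*} (H : Hypergraph α) : Prop :=
  ∀ u ∈ H.vertexSet, ∀ v ∈ H.vertexSet, Relation.ReflTransGen H.Adj u v

/-- The rank `max {|e| : e ∈ E}` of a finite hypergraph (`0` if there are no edges). -/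
noncomputable def rank {α : Type*} (H : Hypergraph α) : ℕ := sSup (Set.ncard '' H.edgeSet)

/-- The closed neighbourhood `N[v]`. -/
def nbhd {α : Type*} (H : Hypergraph α) (v : α) : Set α := {u | H.Adj u v} ∪ {v}

/-- The condition on an edge `e` to be dispensable; all inclusions are strict. -/
def IsDispensable {α : Type*} (H : Hypergraph α) (e : Set α) : Prop :=
  ∃ z ∈ H.vertexSet, ∃ x ∈ e, ∃ y ∈ e, x ≠ y ∧
    (H.nbhd x ∩ H.nbhd y ⊂ H.nbhd x ∩ H.nbhd z ∨
      (H.nbhd x ⊂ H.nbhd z ∧ H.nbhd z ⊂ H.nbhd y)) ∧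
    (H.nbhd x ∩ H.nbhd y ⊂ H.nbhd y ∩ H.nbhd z ∨
      (H.nbhd y ⊂ H.nbhd z ∧ H.nbhd z ⊂ H.nbhd x))

/-- The set `D(H)` of dispensable edges. -/
def dispensableEdges {α : Type*} (H : Hypergraph α) : Set (Set α) :=
  {e | e ∈ H.edgeSet ∧ H.IsDispensable e}

/-- The Cartesian skeleton: same vertices, all dispensable edges removed. -/
def skeleton {α : Type*} (H : Hypergraph α) : Hypergraph α where
  vertexSet := H.vertexSet
  edgeSet := H.edgeSet \ H.dispensableEdges
  subset_vertexSet_of_mem_edgeSet' := fun _ he => H.subset_vertexSet_of_mem_edgeSet' he.1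

/-- The 2-section: its edges are the pairs of distinct vertices lying in a common edge. -/
def twoSection {α : Type*} (H : Hypergraph α) : Hypergraph α where
  vertexSet := H.vertexSet
  edgeSet := {p | ∃ x y : α, x ≠ y ∧ p = {x, y} ∧ ∃ e ∈ H.edgeSet, {x, y} ⊆ e}
  subset_vertexSet_of_mem_edgeSet' := by
    rintro p ⟨x, y, -, rfl, e, he, hp⟩
    exact hp.trans (H.subset_vertexSet_of_mem_edgeSet' he)

/-- `L` lists every edge of `H` exactly once, each edge as a list of its vertices without
repetition. -/
def IsListing {α : Type*} (H : Hypergraph α) (L : List (List α)) : Prop :=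
  (∀ l ∈ L, l.Nodup) ∧ (L.map fun l => {v | v ∈ l}).Nodup ∧
    ∀ e : Set α, e ∈ L.map (fun l => {v | v ∈ l}) ↔ e ∈ H.edgeSet

end Hypergraph

/-! ### A random access machine language with unit costs

The memory consists of finitely many integer variables and two-dimensional tables. Reading a
variable, a constant or a table entry, adding, comparing, a Boolean connective, an assignment
and a branch cost one unit each; a loop pays for its bound, for its set-up and, in every
iteration, for the update and the test of its counter. -/

namespace SkeletonRAM

/-- The integer variables of the programs. -/
inductive Var
  | n | m | e | i | j | k | x | y | z | w | cxy | cxz | cyz | cxyz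
  deriving DecidableEq

/-- The tables. Tables that need only one index are used with second index `0`. -/
inductive Tab
  | size | vert | alive | inc | adj | deg | nb | disp
  deriving DecidableEq

/-- Memory contents. -/
structure Mem where
  var : Var → ℕ
  tab : Tab → ℕ → ℕ → ℕ

/-- Store `v` in the variable `u`. -/
def Mem.setVar (s : Mem) (u : Var) (v : ℕ) : Mem :=
  { s with var := fun u' => if u' = u then v else s.var u' }

/-- Store `v` in the table entry `A[p][q]`. -/
def Mem.setTab (s : Mem) (A : Tab) (p q v : ℕ) : Mem :=
  { s with tab := fun A' p' q' => if A' = A ∧ p' = p ∧ q' = q then v else s.tab A' p' q' }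

inductive Expr
  | const (c : ℕ)
  | var (u : Var)
  | get (A : Tab) (a b : Expr)
  | add (a b : Expr)

def Expr.eval (s : Mem) : Expr → ℕ
  | .const c => c
  | .var u => s.var u
  | .get A a b => s.tab A (a.eval s) (b.eval s)
  | .add a b => a.eval s + b.eval s

def Expr.cost : Expr → ℕ
  | .const _ => 1
  | .var _ => 1
  | .get _ a b => a.cost + b.cost + 1
  | .add a b => a.cost + b.cost + 1

inductive Test
  | eq (a b : Expr)
  | lt (a b : Expr)
  | and (p q : Test)
  | or (p q : Test)
  | not (p : Test)

def Test.eval (s : Mem) : Test → Bool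
  | .eq a b => a.eval s == b.eval s
  | .lt a b => decide (a.eval s < b.eval s)
  | .and p q => p.eval s && q.eval s
  | .or p q => p.eval s || q.eval s
  | .not p => !p.eval s

def Test.cost : Test → ℕ
  | .eq a b => a.cost + b.cost + 1
  | .lt a b => a.cost + b.cost + 1
  | .and p q => p.cost + q.cost + 1
  | .or p q => p.cost + q.cost + 1
  | .not p => p.cost + 1

inductive Cmd
  | skip
  /-- `u := a` -/
  | set (u : Var) (a : Expr)
  /-- `A[a][b] := c` -/
  | put (A : Tab) (a b c : Expr)
  /-- first `c`, then `d` -/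
  | seq (c d : Cmd)
  /-- `if p then c` -/
  | cond (p : Test) (c : Cmd)
  /-- `for u = 0, …, a - 1 do c`, where `a` is evaluated once, before the loop -/
  | loop (u : Var) (a : Expr) (c : Cmd)

/-- The memory after the execution of a program, and the number of steps taken. -/
def Cmd.run : Cmd → Mem → Mem × ℕ
  | .skip, s => (s, 0)
  | .set u a, s => (s.setVar u (a.eval s), a.cost + 1)
  | .put A a b c, s =>
      (s.setTab A (a.eval s) (b.eval s) (c.eval s), a.cost + b.cost + c.cost + 1)
  | .seq c d, s =>
      ((d.run (c.run s).1).1, (c.run s).2 + (d.run (c.run s).1).2)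
  | .cond p c, s =>
      if p.eval s then ((c.run s).1, p.cost + 1 + (c.run s).2) else (s, p.cost + 1)
  | .loop u a c, s =>
      Nat.rec (motive := fun _ => Mem × ℕ) (s, a.cost + 1)
        (fun v r => ((c.run (r.1.setVar u v)).1, r.2 + 2 + (c.run (r.1.setVar u v)).2))
        (a.eval s)

/-- Sequential composition of a list of programs. -/
def block : List Cmd → Cmd
  | [] => .skip
  | c :: cs => .seq c (block cs)

/-- The table entry `A[u][v]`, for variables `u` and `v`. -/
abbrev entry (A : Tab) (u v : Var) : Expr := .get A (.var u) (.var v)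

/-- The table entry `A[u]` of a table with one index. -/
abbrev entry₁ (A : Tab) (u : Var) : Expr := .get A (.var u) (.const 0)

/-- `A[u][v] = 1` -/
abbrev flag (A : Tab) (u v : Var) : Test := .eq (entry A u v) (.const 1)

/-- `u := u + 1` -/
abbrev incr (u : Var) : Cmd := .set u (.add (.var u) (.const 1))

/-- Fill in the incidence table `inc[e][x]` of the hypergraph and the table `adj[x][y]`, which
marks the pairs with `x ∈ N[y]`. -/
def buildTwoSection : Cmd := block [
  .loop .x (.var .n) (.put .adj (.var .x) (.var .x) (.const 1)),
  .loop .e (.var .m) (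
    .loop .i (entry₁ .size .e) (block [
      .set .x (entry .vert .e .i),
      .put .inc (.var .e) (.var .x) (.const 1),
      .loop .j (entry₁ .size .e) (
        .put .adj (.var .x) (entry .vert .e .j) (.const 1))]))]

/-- List the closed neighbourhoods: `N[x] = {nb[x][0], …, nb[x][deg[x] - 1]}`. -/
def buildNeighbourLists : Cmd :=
  .loop .x (.var .n) (.loop .y (.var .n) (.cond (flag .adj .x .y) (block [
    .put .nb (.var .x) (entry₁ .deg .x) (.var .y),
    .put .deg (.var .x) (.const 0) (.add (entry₁ .deg .x) (.const 1))])))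

/-- The two conditions in the definition of dispensability, expressed through the numbers
`cxy = |N[x] ∩ N[y]|`, `cxz = |N[x] ∩ N[z]|`, `cyz = |N[y] ∩ N[z]|`,
`cxyz = |N[x] ∩ N[y] ∩ N[z]|` and through the sizes `deg[x]`, `deg[y]`, `deg[z]` of the closed
neighbourhoods. -/
def dispensabilityTest : Test :=
  .and
    (.or
      (.and (.eq (.var .cxyz) (.var .cxy)) (.lt (.var .cxy) (.var .cxz)))
      (.and
        (.and (.eq (.var .cxz) (entry₁ .deg .x)) (.lt (entry₁ .deg .x) (entry₁ .deg .z)))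
        (.and (.eq (.var .cyz) (entry₁ .deg .z)) (.lt (entry₁ .deg .z) (entry₁ .deg .y)))))
    (.or
      (.and (.eq (.var .cxyz) (.var .cxy)) (.lt (.var .cxy) (.var .cyz)))
      (.and
        (.and (.eq (.var .cyz) (entry₁ .deg .y)) (.lt (entry₁ .deg .y) (entry₁ .deg .z)))
        (.and (.eq (.var .cxz) (entry₁ .deg .z)) (.lt (entry₁ .deg .z) (entry₁ .deg .x)))))

/-- For every edge `{x, y}` of the 2-section and every vertex `z`, run the test and mark the
dispensable edges in the table `disp[x][y]`. -/
def markDispensable : Cmd :=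
  .loop .x (.var .n) (.loop .y (.var .n) (
    .cond (.and (flag .adj .x .y) (.not (.eq (.var .x) (.var .y)))) (block [
      .set .cxy (.const 0),
      .loop .w (.var .n) (.cond (.and (flag .adj .x .w) (flag .adj .y .w)) (incr .cxy)),
      .loop .z (.var .n) (block [
        .set .cxz (.const 0),
        .set .cyz (.const 0),
        .set .cxyz (.const 0),
        .loop .k (entry₁ .deg .z) (block [
          .set .w (entry .nb .z .k),
          .cond (flag .adj .x .w) (incr .cxz),
          .cond (flag .adj .y .w) (incr .cyz),
          .cond (.and (flag .adj .x .w) (flag .adj .y .w)) (incr .cxyz)]),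
        .cond dispensabilityTest (.put .disp (.var .x) (.var .y) (.const 1))])])))

/-- First step of the algorithm: compute the set `D([H]₂)` of dispensable edges of the
2-section. -/
def computeDispensable : Cmd :=
  block [buildTwoSection, buildNeighbourLists, markDispensable]

/-- Second step: for every edge `{x, y}` in `D([H]₂)`, remove all edges `e` with `x, y ∈ e`. -/
def deleteEdges : Cmd :=
  .loop .x (.var .n) (.loop .y (.var .n) (.cond (flag .disp .x .y) (
    .loop .e (.var .m) (.cond (.and (flag .inc .e .x) (flag .inc .e .y))
      (.put .alive (.var .e) (.const 0) (.const 0))))))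

/-- The algorithm for the Cartesian skeleton. -/
def cartesianSkeletonAlgorithm : Cmd := .seq computeDispensable deleteEdges

/-- The memory at the start, for a hypergraph with vertices `0, …, n - 1` whose edges are listed
in `L`. The variable `m` holds the length of `L`, the vertices of edge number `e` are `vert[e][i]`
for `i < size[e]`, and `alive[e] = 1` says that the edge is present. The rest of the memory
is `0`. -/
def load (n : ℕ) (L : List (List ℕ)) : Mem where
  var
    | .n => n
    | .m => L.length
    | _ => 0
  tab
    | .size => fun p q => if q = 0 then (L.getD p []).length else 0
    | .vert => fun p q => (L.getD p []).getD q 0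
    | .alive => fun p q => if q = 0 ∧ p < L.length then 1 else 0
    | _ => fun _ _ => 0

/-- The vertex set of edge number `p` in the memory. -/
def Mem.edge (s : Mem) (p : ℕ) : Set ℕ :=
  {v | ∃ q < s.tab .size p 0, s.tab .vert p q = v}

/-- The memory represents the hypergraph `H` on `{0, …, n - 1}`: it holds the number of vertices,
and the edges that are present in the memory are exactly those of `H`. -/
def Mem.Represents (s : Mem) (H : Hypergraph ℕ) : Prop :=
  H.vertexSet = {v | v < s.var .n} ∧
  H.edgeSet = {e | ∃ p < s.var .m, s.tab .alive p 0 = 1 ∧ s.edge p = e}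

end SkeletonRAM

/-! Correctness rests on one observation: whether `z` witnesses dispensability through `x` and `y`
depends only on `N[x]`, `N[y]`, `N[z]`, and a hypergraph and its 2-section have the same vertices
and the same closed neighbourhoods (`nbhd_twoSection`). Hence an edge `e` is dispensable in `H`
exactly when it contains a pair belonging to `D([H]₂)`, so deleting all edges that contain such a
pair leaves the skeleton (`run_represents_skeleton`). Testing by counting is legitimate because for
finite sets `A ⊂ B` means `|A ∩ B| = |A| < |B|` (`Set.dispenses_iff_ncard`).

For the running time let `S` be the sum of all `|N[z]|` (`nbhdSum`) and `n = |V|`. Running through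
every `N[z]` costs `O(n + S)` for one pair `x, y`, and there are at most `S` ordered adjacent pairs.
Marking therefore takes `O(n² + S(1 + n + S))` steps and deletion `O(n² + S(1 + |E|))`; the tables
cost `O(1 + n² + |E| + ∑ |e|²)`. Adjacent pairs lie in edges, so `S ≤ n + |E|r²` (`nbhdSum_le`), and
connectedness gives `n ≤ max 1 (|E|r)` (`ncard_vertexSet_le`). Everything is thus `O(X²)` with `X =
max 1 (|E|r²)`.

The programs are analysed with a loop invariant rule that also bounds the steps
(`Cmd.run_loop_induction`), for arbitrary initial memories. The results are specialised to `load`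
and then transported along the numbering of the vertices. -/

namespace SkeletonRAM

/-! ### Reasoning about programs -/

/-- Does the program contain an assignment to the variable? -/
def Cmd.writesVar : Cmd → Var → Bool
  | .skip, _ => false
  | .set u _, u' => decide (u = u')
  | .put _ _ _ _, _ => false
  | .seq c d, u' => c.writesVar u' || d.writesVar u'
  | .cond _ c, u' => c.writesVar u'
  | .loop u _ c, u' => decide (u = u') || c.writesVar u'

/-- Does the program contain an assignment to an entry of the table? -/
def Cmd.writesTab : Cmd → Tab → Bool
  | .skip, _ => false
  | .set _ _, _ => false
  | .put A _ _ _, B => decide (A = B)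
  | .seq c d, B => c.writesTab B || d.writesTab B
  | .cond _ c, B => c.writesTab B
  | .loop _ _ c, B => c.writesTab B

theorem Cmd.run_skip (s : Mem) : Cmd.skip.run s = (s, 0) := rfl

theorem Cmd.run_set (u : Var) (a : Expr) (s : Mem) :
    (Cmd.set u a).run s = (s.setVar u (a.eval s), a.cost + 1) := rfl

theorem Cmd.run_put (A : Tab) (a b c : Expr) (s : Mem) :
    (Cmd.put A a b c).run s =
      (s.setTab A (a.eval s) (b.eval s) (c.eval s), a.cost + b.cost + c.cost + 1) := rfl

theorem Cmd.run_seq (c d : Cmd) (s : Mem) :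
    (Cmd.seq c d).run s = ((d.run (c.run s).1).1, (c.run s).2 + (d.run (c.run s).1).2) := rfl

theorem Cmd.run_cond (p : Test) (c : Cmd) (s : Mem) :
    (Cmd.cond p c).run s =
      if p.eval s then ((c.run s).1, p.cost + 1 + (c.run s).2) else (s, p.cost + 1) := rfl

/-- A frame rule: the hypothesis is a syntactic check, so for a concrete program it is settled by
`rfl`. -/
theorem Cmd.run_var_of_not_writesVar {c : Cmd} {u' : Var} (h : c.writesVar u' = false) (s : Mem) :
    (c.run s).1.var u' = s.var u' := by
  induction c generalizing s with
  | skip => rfl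
  | set u a =>
    have : ¬ u' = u := fun e => by simp [Cmd.writesVar, e] at h
    simp [Cmd.run_set, Mem.setVar, this]
  | put A a b c => rfl
  | seq c d hc hd =>
    simp only [Cmd.writesVar, Bool.or_eq_false_iff] at h
    simp [Cmd.run_seq, hc h.1, hd h.2]
  | cond p c hc =>
    rw [Cmd.run_cond]
    split
    · exact hc h s
    · rfl
  | loop u a c hc =>
    simp only [Cmd.writesVar, Bool.or_eq_false_iff, decide_eq_false_iff_not] at h
    simp only [Cmd.run]
    induction a.eval s with
    | zero => rfl
    | succ v ih => rw [hc h.2, ← ih]; simp [Mem.setVar, Ne.symm h.1]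

theorem Cmd.run_tab_of_not_writesTab {c : Cmd} {A : Tab} (h : c.writesTab A = false) (s : Mem) :
    (c.run s).1.tab A = s.tab A := by
  induction c generalizing s with
  | skip => rfl
  | set u a => rfl
  | put B a b c =>
    have : ¬ A = B := fun e => by simp [Cmd.writesTab, e] at h
    simp [Cmd.run_put, Mem.setTab, this]
  | seq c d hc hd =>
    simp only [Cmd.writesTab, Bool.or_eq_false_iff] at h
    simp [Cmd.run_seq, hc h.1, hd h.2]
  | cond p c hc =>
    rw [Cmd.run_cond]
    split
    · exact hc h s
    · rfl
  | loop u a c hc =>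
    simp only [Cmd.run]
    induction a.eval s with
    | zero => rfl
    | succ v ih => rw [hc h, ← ih]; rfl

/-- Loop invariants, with a bound on the number of steps of every iteration. What the loop does not
write may be assumed to be unchanged. -/
theorem Cmd.run_loop_induction {u : Var} {a : Expr} {c : Cmd} {s : Mem} (I : ℕ → Mem → Prop)
    (f : ℕ → ℕ) (h0 : I 0 s)
    (hstep : ∀ v < a.eval s, ∀ t : Mem,
      (∀ u', (Cmd.loop u a c).writesVar u' = false → t.var u' = s.var u') →
      (∀ A, c.writesTab A = false → t.tab A = s.tab A) → I v t →
      I (v + 1) (c.run (t.setVar u v)).1 ∧ (c.run (t.setVar u v)).2 ≤ f v) :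
    I (a.eval s) ((Cmd.loop u a c).run s).1 ∧
      ((Cmd.loop u a c).run s).2 ≤ a.cost + 1 + ∑ v ∈ Finset.range (a.eval s), (f v + 2) := by
  -- The induction carries the frame conditions along with the invariant. The state after `N`
  -- iterations is named `r` so that the recursor can be generalized away in the step.
  suffices h : ∀ N ≤ a.eval s, ∀ r : Mem × ℕ,
      r = Nat.rec (motive := fun _ => Mem × ℕ) (s, a.cost + 1)
        (fun v r => ((c.run (r.1.setVar u v)).1, r.2 + 2 + (c.run (r.1.setVar u v)).2)) N →
      ((∀ u', (Cmd.loop u a c).writesVar u' = false → r.1.var u' = s.var u') ∧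
        (∀ A, c.writesTab A = false → r.1.tab A = s.tab A)) ∧ I N r.1 ∧
        r.2 ≤ a.cost + 1 + ∑ v ∈ Finset.range N, (f v + 2) from
    (h _ le_rfl _ rfl).2
  intro N hN
  induction N with
  | zero =>
    rintro r rfl
    simpa using h0
  | succ N ih =>
    rintro r rfl
    obtain ⟨⟨hv, ht⟩, hI, hc⟩ := ih (by omega) _ rfl
    dsimp only
    generalize Nat.rec (motive := fun _ => Mem × ℕ) _ _ N = r at hv ht hI hc ⊢
    obtain ⟨h1, h2⟩ := hstep N (by omega) r.1 hv ht hI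
    refine ⟨⟨fun u' hu => ?_, fun A hA => ?_⟩, h1, ?_⟩
    · have hu' := hu
      simp only [Cmd.writesVar, Bool.or_eq_false_iff, decide_eq_false_iff_not] at hu'
      rw [Cmd.run_var_of_not_writesVar hu'.2, ← hv u' hu]
      simp [Mem.setVar, Ne.symm hu'.1]
    · rw [Cmd.run_tab_of_not_writesTab hA, ← ht A hA]
      rfl
    · rw [Finset.sum_range_succ]
      omega

end SkeletonRAM

namespace SkeletonRAM

/-! ### The tables of the 2-section -/

/-- The innermost loop of `buildTwoSection`: all vertices of the edge `e` are adjacent to `x`. -/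
def markRow : Cmd :=
  .loop .j (entry₁ .size .e) (.put .adj (.var .x) (entry .vert .e .j) (.const 1))

/-- The middle loop of `buildTwoSection`, for one edge `e`. -/
def tabulateEdge : Cmd :=
  .loop .i (entry₁ .size .e) (block [
    .set .x (entry .vert .e .i),
    .put .inc (.var .e) (.var .x) (.const 1),
    markRow])

theorem markRow_spec (s : Mem) :
    (∀ p q, (markRow.run s).1.tab .adj p q = 1 ↔ s.tab .adj p q = 1 ∨
      ∃ j < s.tab .size (s.var .e) 0, p = s.var .x ∧ q = s.tab .vert (s.var .e) j) ∧
    (markRow.run s).2 ≤ 4 + 8 * s.tab .size (s.var .e) 0 := by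
  obtain ⟨h1, h2⟩ := Cmd.run_loop_induction (u := .j) (a := entry₁ .size .e)
    (c := .put .adj (.var .x) (entry .vert .e .j) (.const 1)) (s := s)
    (fun v t => ∀ p q, t.tab .adj p q = 1 ↔ s.tab .adj p q = 1 ∨
      ∃ j < v, p = s.var .x ∧ q = s.tab .vert (s.var .e) j) (fun _ => 6) (by simp) (by
    intro v _ t hvar htab hI
    have hx := hvar .x rfl
    have he := hvar .e rfl
    have hvert := htab .vert rfl
    refine ⟨fun p q => ?_, by simp [Cmd.run_put, Expr.cost]⟩
    rw [Nat.exists_lt_succ_right, ← or_assoc, ← hI p q]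
    simp only [Cmd.run_put, Mem.setTab, Mem.setVar, Expr.eval, hvert]
    simp only [reduceCtorEq, if_false, if_true, hx, he, true_and]
    split_ifs <;> tauto)
  refine ⟨h1, h2.trans ?_⟩
  simp [Expr.eval, Expr.cost]
  omega

/-- The quadratic term comes from running `markRow` once for each vertex of the edge: all ordered
pairs in `e` are marked. Tables are described only by which entries equal `1`, since no other value
is ever written to them. -/
theorem tabulateEdge_spec (s : Mem) :
    (∀ p q, (tabulateEdge.run s).1.tab .adj p q = 1 ↔ s.tab .adj p q = 1 ∨
      ∃ i < s.tab .size (s.var .e) 0, p = s.tab .vert (s.var .e) i ∧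
        ∃ j < s.tab .size (s.var .e) 0, q = s.tab .vert (s.var .e) j) ∧
    (∀ p q, (tabulateEdge.run s).1.tab .inc p q = 1 ↔ s.tab .inc p q = 1 ∨
      ∃ i < s.tab .size (s.var .e) 0, p = s.var .e ∧ q = s.tab .vert (s.var .e) i) ∧
    (tabulateEdge.run s).2 ≤
      4 + 14 * s.tab .size (s.var .e) 0 + 8 * s.tab .size (s.var .e) 0 ^ 2 := by
  obtain ⟨⟨h1, h1'⟩, h2⟩ := Cmd.run_loop_induction (u := .i) (a := entry₁ .size .e)
    (c := block [.set .x (entry .vert .e .i), .put .inc (.var .e) (.var .x) (.const 1),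
      markRow]) (s := s)
    (fun v t => (∀ p q, t.tab .adj p q = 1 ↔ s.tab .adj p q = 1 ∨
      ∃ i < v, p = s.tab .vert (s.var .e) i ∧
        ∃ j < s.tab .size (s.var .e) 0, q = s.tab .vert (s.var .e) j) ∧
      ∀ p q, t.tab .inc p q = 1 ↔ s.tab .inc p q = 1 ∨
        ∃ i < v, p = s.var .e ∧ q = s.tab .vert (s.var .e) i)
    (fun _ => 12 + 8 * s.tab .size (s.var .e) 0) (by simp) (by
    rintro v _ t hvar htab ⟨hI, hI'⟩
    have he := hvar .e rfl
    have hvert := htab .vert rfl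
    have hsize := htab .size rfl
    simp only [block, Cmd.run_seq, Cmd.run_skip, Cmd.run_set, Cmd.run_put]
    generalize ht' : Mem.setTab _ _ _ _ _ = t'
    obtain ⟨h1, h2⟩ := markRow_spec t'
    have hinc : (markRow.run t').1.tab .inc = t'.tab .inc :=
      Cmd.run_tab_of_not_writesTab rfl t'
    have e1 : t'.tab .adj = t.tab .adj := by subst ht'; simp [Mem.setTab, Mem.setVar]
    have e2 : t'.tab .vert = s.tab .vert := by subst ht'; simp [Mem.setTab, Mem.setVar, hvert]
    have e3 : t'.tab .size = s.tab .size := by subst ht'; simp [Mem.setTab, Mem.setVar, hsize]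
    have e4 : t'.var .e = s.var .e := by subst ht'; simp [Mem.setTab, Mem.setVar, he]
    have e5 : t'.var .x = s.tab .vert (s.var .e) v := by
      subst ht'; simp [Mem.setTab, Mem.setVar, Expr.eval, he, hvert]
    have e6 : ∀ p q, t'.tab .inc p q = 1 ↔ t.tab .inc p q = 1 ∨
        p = s.var .e ∧ q = s.tab .vert (s.var .e) v := by
      intro p q
      subst ht'
      simp only [Mem.setTab, Mem.setVar, Expr.eval, hvert]
      simp only [reduceCtorEq, if_false, if_true, he, true_and]
      split_ifs <;> tauto
    simp only [e1, e2, e3, e4, e5] at h1 h2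
    refine ⟨⟨fun p q => ?_, fun p q => ?_⟩, ?_⟩
    · rw [Nat.exists_lt_succ_right, ← or_assoc, ← hI p q, h1]
      grind
    · rw [Nat.exists_lt_succ_right, ← or_assoc, ← hI' p q, hinc, e6]
    · simp [Expr.cost]
      omega)
  refine ⟨h1, h1', h2.trans ?_⟩
  simp [Expr.eval, Expr.cost]
  nlinarith

theorem buildTwoSection_spec (s : Mem) :
    (∀ p q, (buildTwoSection.run s).1.tab .adj p q = 1 ↔ s.tab .adj p q = 1 ∨
      (p < s.var .n ∧ p = q) ∨ ∃ e < s.var .m,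
      ∃ i < s.tab .size e 0, p = s.tab .vert e i ∧
        ∃ j < s.tab .size e 0, q = s.tab .vert e j) ∧
    (∀ p q, (buildTwoSection.run s).1.tab .inc p q = 1 ↔ s.tab .inc p q = 1 ∨
      p < s.var .m ∧ ∃ i < s.tab .size p 0, q = s.tab .vert p i) ∧
    (buildTwoSection.run s).2 ≤ 4 + 6 * s.var .n +
      ∑ e ∈ Finset.range (s.var .m), (6 + 14 * s.tab .size e 0 + 8 * s.tab .size e 0 ^ 2) := by
  have hdiag := Cmd.run_loop_induction (u := .x) (a := .var .n)
    (c := .put .adj (.var .x) (.var .x) (.const 1)) (s := s)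
    (fun v t => ∀ p q, t.tab .adj p q = 1 ↔ s.tab .adj p q = 1 ∨
      ∃ i < v, p = i ∧ q = i) (fun _ => 4) (by simp) (by
    rintro v _ t hvar htab hI
    refine ⟨fun p q => ?_, by simp [Cmd.run_put, Expr.cost]⟩
    rw [Nat.exists_lt_succ_right, ← or_assoc, ← hI p q]
    simp only [Cmd.run_put, Mem.setTab, Mem.setVar, Expr.eval, if_true, true_and]
    split_ifs <;> tauto)
  have hfv : ∀ u', (Cmd.loop .x (.var .n)
      (.put .adj (.var .x) (.var .x) (.const 1))).writesVar u' = false →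
      ((Cmd.loop .x (.var .n) (.put .adj (.var .x) (.var .x) (.const 1))).run s).1.var u' =
        s.var u' := fun _ h => Cmd.run_var_of_not_writesVar h s
  have hft : ∀ A, (Cmd.loop .x (.var .n)
      (.put .adj (.var .x) (.var .x) (.const 1))).writesTab A = false →
      ((Cmd.loop .x (.var .n) (.put .adj (.var .x) (.var .x) (.const 1))).run s).1.tab A =
        s.tab A := fun _ h => Cmd.run_tab_of_not_writesTab h s
  have hmain : ∀ s : Mem, _ := fun s => Cmd.run_loop_induction (u := .e) (a := .var .m)
    (c := tabulateEdge) (s := s)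
    (fun v t => (∀ p q, t.tab .adj p q = 1 ↔ s.tab .adj p q = 1 ∨ ∃ e < v,
      ∃ i < s.tab .size e 0, p = s.tab .vert e i ∧
        ∃ j < s.tab .size e 0, q = s.tab .vert e j) ∧
      ∀ p q, t.tab .inc p q = 1 ↔ s.tab .inc p q = 1 ∨
        ∃ e < v, ∃ i < s.tab .size e 0, p = e ∧ q = s.tab .vert e i)
    (fun e => 4 + 14 * s.tab .size e 0 + 8 * s.tab .size e 0 ^ 2) (by simp) (by
    rintro v _ t hvar htab ⟨hI, hI'⟩
    have hvert := htab .vert rfl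
    have hsize := htab .size rfl
    obtain ⟨h1, h2, h3⟩ := tabulateEdge_spec (t.setVar .e v)
    simp only [Mem.setVar, hvert, hsize, if_true] at h1 h2 h3
    refine ⟨⟨fun p q => ?_, fun p q => ?_⟩, h3⟩
    · rw [Nat.exists_lt_succ_right, ← or_assoc, ← hI p q, ← h1]; rfl
    · rw [Nat.exists_lt_succ_right, ← or_assoc, ← hI' p q, ← h2]; rfl)
  obtain ⟨d1, d2⟩ := hdiag
  -- By definition the second loop of `buildTwoSection` has body `tabulateEdge`; the `+ 0` is the
  -- cost of the `skip` that closes a block.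
  change (∀ p q, ((Cmd.loop .e (.var .m) tabulateEdge).run _).1.tab .adj p q = 1 ↔ _) ∧
    (∀ p q, ((Cmd.loop .e (.var .m) tabulateEdge).run _).1.tab .inc p q = 1 ↔ _) ∧
    _ + (((Cmd.loop .e (.var .m) tabulateEdge).run _).2 + 0) ≤ _
  generalize (Cmd.loop .x (.var .n) (.put .adj (.var .x) (.var .x) (.const 1))).run s = r
    at d1 d2 hfv hft ⊢
  obtain ⟨⟨m1, m2⟩, m3⟩ := hmain r.1
  simp only [Expr.eval, Expr.cost, hfv .m rfl, hft .size rfl, hft .vert rfl,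
    hft .inc rfl] at d1 d2 m1 m2 m3
  refine ⟨fun p q => ?_, fun p q => ?_, ?_⟩
  · rw [m1, d1, or_assoc]
    grind
  · rw [m2]
    grind
  · simp at d2
    have : ∀ x, 4 + 14 * x + 8 * x ^ 2 + 2 = 6 + 14 * x + 8 * x ^ 2 := fun x => by ring
    simp only [this] at m3
    omega

/-! ### The lists of neighbours -/

/-- `deg[x]` serves as the write position in row `x` of `nb`, so it must start at `0`. Appending `y`
whenever it is adjacent to `x` mirrors `List.filter` on a growing `List.range`. -/
theorem buildNeighbourLists_spec (s : Mem) (hdeg : ∀ p, s.tab .deg p 0 = 0) :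
    (∀ x < s.var .n, (List.range ((buildNeighbourLists.run s).1.tab .deg x 0)).map
      ((buildNeighbourLists.run s).1.tab .nb x) =
        (List.range (s.var .n)).filter (s.tab .adj x · == 1)) ∧
    (buildNeighbourLists.run s).2 ≤ 2 + 4 * s.var .n + 22 * s.var .n ^ 2 := by
  -- The inner loop is treated for any initial memory, as each outer iteration starts it from a
  -- different one. The second half of the invariant protects the rows that are already complete and
  -- those still empty.
  have hrow : ∀ s : Mem, s.tab .deg (s.var .x) 0 = 0 → _ := fun s hd =>
    Cmd.run_loop_induction (u := .y) (a := .var .n)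
    (c := .cond (flag .adj .x .y) (block [
      .put .nb (.var .x) (entry₁ .deg .x) (.var .y),
      .put .deg (.var .x) (.const 0) (.add (entry₁ .deg .x) (.const 1))])) (s := s)
    (fun v t => (List.range (t.tab .deg (s.var .x) 0)).map (t.tab .nb (s.var .x)) =
        (List.range v).filter (s.tab .adj (s.var .x) · == 1) ∧
      ∀ p, p ≠ s.var .x → t.tab .deg p 0 = s.tab .deg p 0 ∧ t.tab .nb p = s.tab .nb p)
    (fun _ => 20) (by simp [hd]) (by
    rintro v _ t hvar htab ⟨hI, hI'⟩
    have hx := hvar .x rfl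
    have hadj := htab .adj rfl
    rw [List.range_succ, List.filter_append, ← hI]
    simp only [Cmd.run_cond, block, Cmd.run_seq, Cmd.run_skip, Cmd.run_put, Test.eval,
      Expr.eval, Expr.cost, Test.cost]
    simp only [Mem.setVar, reduceCtorEq, if_false, if_true, hx, hadj]
    by_cases h : s.tab .adj (s.var .x) v = 1
    · simp only [h, List.filter_cons, List.filter_nil, beq_self_eq_true, if_true]
      refine ⟨⟨?_, fun p hp => ?_⟩, by omega⟩
      · simp only [Mem.setTab, reduceCtorEq, if_false, if_true, false_and, and_self, hx,
          List.range_succ, List.map_append, List.map_cons, List.map_nil, true_and]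
        congr 1
        refine List.map_congr_left fun k hk => ?_
        have := List.mem_range.1 hk
        rw [if_neg (by omega)]
      · rw [← (hI' p hp).1, ← (hI' p hp).2]
        simp [Mem.setTab, hx, hp]
    · simp only [beq_iff_eq, h, List.filter_cons, List.filter_nil, if_false, List.append_nil]
      exact ⟨⟨trivial, hI'⟩, by omega⟩)
  obtain ⟨h1, h2⟩ := Cmd.run_loop_induction (u := .x) (a := .var .n)
    (c := .loop .y (.var .n) (.cond (flag .adj .x .y) (block [
      .put .nb (.var .x) (entry₁ .deg .x) (.var .y),
      .put .deg (.var .x) (.const 0) (.add (entry₁ .deg .x) (.const 1))]))) (s := s)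
    (fun v t => (∀ x < v, (List.range (t.tab .deg x 0)).map (t.tab .nb x) =
        (List.range (s.var .n)).filter (s.tab .adj x · == 1)) ∧
      ∀ p, v ≤ p → t.tab .deg p 0 = 0)
    (fun _ => 2 + 22 * s.var .n) (by simpa using hdeg) (by
    rintro v _ t hvar htab ⟨hI, hI'⟩
    have hn := hvar .n rfl
    have hadj := htab .adj rfl
    obtain ⟨⟨h1, h2⟩, h3⟩ := hrow (t.setVar .x v) (hI' _ le_rfl)
    simp only [Mem.setVar, reduceCtorEq, if_false, if_true, Expr.eval, hadj, hn] at h1 h2 h3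
    refine ⟨⟨fun p hp => ?_, fun p hp => ?_⟩, h3.trans ?_⟩
    · rcases Nat.lt_succ_iff_lt_or_eq.1 hp with hp | rfl
      · have := h2 p hp.ne
        rw [← hI p hp]
        simp only [← this.1, ← this.2]; rfl
      · exact h1
    · exact (h2 p (by omega)).1.trans (hI' p (by omega))
    · simp [Expr.cost]
      omega)
  refine ⟨h1.1, h2.trans ?_⟩
  simp [Expr.eval, Expr.cost]
  nlinarith

end SkeletonRAM

/-! ### Testing dispensability by counting -/

/-- The condition on the closed neighbourhoods `A`, `B`, `C` of `x`, `y`, `z` for the vertex `z` to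
witness that an edge with the vertices `x` and `y` is dispensable. -/
def Set.Dispenses {α : Type*} (A B C : Set α) : Prop :=
  (A ∩ B ⊂ A ∩ C ∨ (A ⊂ C ∧ C ⊂ B)) ∧ (A ∩ B ⊂ B ∩ C ∨ (B ⊂ C ∧ C ⊂ A))

theorem Set.Dispenses.symm {α : Type*} {A B C : Set α} (h : A.Dispenses B C) :
    B.Dispenses A C := by
  rw [Set.Dispenses, Set.inter_comm B A]
  exact ⟨h.2, h.1⟩

theorem Set.ssubset_iff_ncard_inter {α : Type*} {A B : Set α} (hA : A.Finite) (hB : B.Finite) :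
    A ⊂ B ↔ (A ∩ B).ncard = A.ncard ∧ A.ncard < B.ncard := by
  constructor
  · intro h
    exact ⟨by rw [Set.inter_eq_left.2 h.subset], Set.ncard_lt_ncard h hB⟩
  · rintro ⟨h1, h2⟩
    have h3 : A ⊆ B := Set.inter_eq_left.1
      (Set.eq_of_subset_of_ncard_le Set.inter_subset_left h1.ge hA)
    exact h3.ssubset_of_ne fun h => by simp [h] at h2

/-- Both `A ∩ B ⊆ A ∩ C` and `A ∩ B ⊆ B ∩ C` say that `A ∩ B ⊆ C`, so the single count `|A ∩ B ∩ C|`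
serves both conditions. -/
theorem Set.dispenses_iff_ncard {α : Type*} {A B C : Set α} (hA : A.Finite) (hB : B.Finite)
    (hC : C.Finite) : A.Dispenses B C ↔
      (((A ∩ B ∩ C).ncard = (A ∩ B).ncard ∧ (A ∩ B).ncard < (A ∩ C).ncard) ∨
        (((A ∩ C).ncard = A.ncard ∧ A.ncard < C.ncard) ∧
          ((B ∩ C).ncard = C.ncard ∧ C.ncard < B.ncard))) ∧
      (((A ∩ B ∩ C).ncard = (A ∩ B).ncard ∧ (A ∩ B).ncard < (B ∩ C).ncard) ∨
        (((B ∩ C).ncard = B.ncard ∧ B.ncard < C.ncard) ∧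
          ((A ∩ C).ncard = C.ncard ∧ C.ncard < A.ncard))) := by
  rw [Set.Dispenses, Set.ssubset_iff_ncard_inter (hA.inter_of_left B) (hA.inter_of_left C),
    Set.ssubset_iff_ncard_inter (hA.inter_of_left B) (hB.inter_of_left C),
    Set.ssubset_iff_ncard_inter hA hC, Set.ssubset_iff_ncard_inter hC hB,
    Set.ssubset_iff_ncard_inter hB hC, Set.ssubset_iff_ncard_inter hC hA,
    Set.inter_comm C B, Set.inter_comm C A]
  have e1 : A ∩ B ∩ (A ∩ C) = A ∩ B ∩ C := by ext; simp; tauto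
  have e2 : A ∩ B ∩ (B ∩ C) = A ∩ B ∩ C := by ext; simp; tauto
  rw [e1, e2]

/-! ### Running the dispensability test on the tables. -/

namespace SkeletonRAM

theorem countP_range_eq_ncard (n : ℕ) (p : ℕ → Bool) :
    (List.range n).countP p = {v | v < n ∧ p v = true}.ncard := by
  have : {v | v < n ∧ p v = true} = ↑((Finset.range n).filter (p · = true)) := by
    ext v
    simp
  rw [this, Set.ncard_coe_finset, List.countP_eq_length_filter]
  simp [Finset.card_def, Multiset.range]

/-- The set listed in row `x` of the 0-1-table `a` with columns `0, …, n - 1`. -/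
def row (n : ℕ) (a : ℕ → ℕ → ℕ) (x : ℕ) : Set ℕ := {v | v < n ∧ a x v = 1}

theorem row_finite (n : ℕ) (a : ℕ → ℕ → ℕ) (x : ℕ) : (row n a x).Finite :=
  (Set.finite_lt_nat n).subset fun _ h => h.1

/-- The table `nb` lists the rows of `adj`, and `deg` holds the lengths of these lists. -/
def Mem.ListsRows (s : Mem) : Prop :=
  ∀ x < s.var .n, (List.range (s.tab .deg x 0)).map (s.tab .nb x) =
    (List.range (s.var .n)).filter (s.tab .adj x · == 1)

theorem Mem.ListsRows.congr {s t : Mem} (h : s.ListsRows) (hn : t.var .n = s.var .n)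
    (hdeg : t.tab .deg = s.tab .deg) (hnb : t.tab .nb = s.tab .nb)
    (hadj : t.tab .adj = s.tab .adj) : t.ListsRows := by
  simpa only [Mem.ListsRows, hn, hdeg, hnb, hadj] using h

/-- This turns counting along the list of `N[x]`, which takes only `deg[x]` iterations, into the
cardinality of a subset of `N[x]`. -/
theorem Mem.ListsRows.countP {s : Mem} (h : s.ListsRows) {x : ℕ} (hx : x < s.var .n)
    (p : ℕ → Bool) : ((List.range (s.tab .deg x 0)).map (s.tab .nb x)).countP p =
      {v | v < s.var .n ∧ s.tab .adj x v = 1 ∧ p v = true}.ncard := by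
  rw [h x hx, List.countP_filter, countP_range_eq_ncard]
  congr 1
  ext v
  simp
  tauto

theorem Mem.ListsRows.deg_eq {s : Mem} (h : s.ListsRows) {x : ℕ} (hx : x < s.var .n) :
    s.tab .deg x 0 = (row (s.var .n) (s.tab .adj) x).ncard := by
  simpa [row] using h.countP hx fun _ => true

/-- The loop of `markDispensable` that runs through the elements of `N[z]`. -/
def countNeighbours : Cmd :=
  .loop .k (entry₁ .deg .z) (block [
    .set .w (entry .nb .z .k),
    .cond (flag .adj .x .w) (incr .cxz),
    .cond (flag .adj .y .w) (incr .cyz),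
    .cond (.and (flag .adj .x .w) (flag .adj .y .w)) (incr .cxyz)])

/-- The body of the loop over `z` in `markDispensable`. -/
def testVertex : Cmd := block [
  .set .cxz (.const 0),
  .set .cyz (.const 0),
  .set .cxyz (.const 0),
  countNeighbours,
  .cond dispensabilityTest (.put .disp (.var .x) (.var .y) (.const 1))]

/-- The loop of `markDispensable` that computes `|N[x] ∩ N[y]|`. -/
def countCommon : Cmd :=
  .loop .w (.var .n) (.cond (.and (flag .adj .x .w) (flag .adj .y .w)) (incr .cxy))

/-- The part of `markDispensable` for one edge `{x, y}`. -/
def testPair : Cmd := block [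
  .set .cxy (.const 0),
  countCommon,
  .loop .z (.var .n) testVertex]

theorem countNeighbours_spec (s : Mem) :
    (let L := (List.range (s.tab .deg (s.var .z) 0)).map (s.tab .nb (s.var .z));
      (countNeighbours.run s).1.var .cxz =
        s.var .cxz + L.countP (s.tab .adj (s.var .x) · == 1) ∧
      (countNeighbours.run s).1.var .cyz =
        s.var .cyz + L.countP (s.tab .adj (s.var .y) · == 1) ∧
      (countNeighbours.run s).1.var .cxyz = s.var .cxyz +
        L.countP fun v => s.tab .adj (s.var .x) v == 1 && s.tab .adj (s.var .y) v == 1) ∧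
    (countNeighbours.run s).2 ≤ 4 + 50 * s.tab .deg (s.var .z) 0 := by
  obtain ⟨h1, h2⟩ := Cmd.run_loop_induction (u := .k) (a := entry₁ .deg .z)
    (c := block [
      .set .w (entry .nb .z .k),
      .cond (flag .adj .x .w) (incr .cxz),
      .cond (flag .adj .y .w) (incr .cyz),
      .cond (.and (flag .adj .x .w) (flag .adj .y .w)) (incr .cxyz)]) (s := s)
    (fun k t => let L := (List.range k).map (s.tab .nb (s.var .z));
      t.var .cxz = s.var .cxz + L.countP (s.tab .adj (s.var .x) · == 1) ∧
      t.var .cyz = s.var .cyz + L.countP (s.tab .adj (s.var .y) · == 1) ∧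
      t.var .cxyz = s.var .cxyz +
        L.countP fun v => s.tab .adj (s.var .x) v == 1 && s.tab .adj (s.var .y) v == 1)
    (fun _ => 48) (by simp) (by
    rintro k _ t hvar htab ⟨hI1, hI2, hI3⟩
    have hx := hvar .x rfl
    have hy := hvar .y rfl
    have hz := hvar .z rfl
    have hadj := htab .adj rfl
    have hnb := htab .nb rfl
    simp only [List.range_succ, List.map_append, List.map_cons, List.map_nil, List.countP_append,
      List.countP_singleton, ← Nat.add_assoc, ← hI1, ← hI2, ← hI3]
    by_cases ha : s.tab .adj (s.var .x) (s.tab .nb (s.var .z) k) = 1 <;>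
    by_cases hb : s.tab .adj (s.var .y) (s.tab .nb (s.var .z) k) = 1 <;>
    simp [Cmd.run_cond, block, Cmd.run_seq, Cmd.run_skip, Cmd.run_set, Test.eval,
      Expr.eval, Expr.cost, Test.cost, Mem.setVar, hx, hy, hz, hadj, hnb, ha, hb])
  refine ⟨h1, h2.trans ?_⟩
  simp [Expr.eval, Expr.cost]
  omega

theorem countCommon_spec (s : Mem) :
    (countCommon.run s).1.var .cxy = s.var .cxy +
      (row (s.var .n) (s.tab .adj) (s.var .x) ∩ row (s.var .n) (s.tab .adj) (s.var .y)).ncard ∧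
    (countCommon.run s).2 ≤ 2 + 20 * s.var .n := by
  obtain ⟨h1, h2⟩ := Cmd.run_loop_induction (u := .w) (a := .var .n)
    (c := .cond (.and (flag .adj .x .w) (flag .adj .y .w)) (incr .cxy)) (s := s)
    (fun k t => t.var .cxy = s.var .cxy + (List.range k).countP
        fun v => s.tab .adj (s.var .x) v == 1 && s.tab .adj (s.var .y) v == 1)
    (fun _ => 18) (by simp) (by
    rintro k _ t hvar htab hI
    have hx := hvar .x rfl
    have hy := hvar .y rfl
    have hadj := htab .adj rfl
    simp only [List.range_succ, List.countP_append, List.countP_singleton, ← Nat.add_assoc, ← hI]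
    by_cases ha : s.tab .adj (s.var .x) k = 1 <;>
    by_cases hb : s.tab .adj (s.var .y) k = 1 <;>
    simp [Cmd.run_cond, Cmd.run_set, Test.eval, Expr.eval, Expr.cost, Test.cost, Mem.setVar,
      hx, hy, hadj, ha, hb])
  refine ⟨?_, h2.trans ?_⟩
  · rw [countP_range_eq_ncard] at h1
    refine h1.trans ?_
    congr 2
    ext v
    simp [row, Expr.eval]
    tauto
  · simp [Expr.eval, Expr.cost]
    omega

theorem testVertex_spec (s : Mem) (hrows : s.ListsRows) (hx : s.var .x < s.var .n)
    (hy : s.var .y < s.var .n) (hz : s.var .z < s.var .n)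
    (hxy : s.var .cxy = (row (s.var .n) (s.tab .adj) (s.var .x) ∩
      row (s.var .n) (s.tab .adj) (s.var .y)).ncard) :
    (∀ p q, (testVertex.run s).1.tab .disp p q = 1 ↔ s.tab .disp p q = 1 ∨
      ((row (s.var .n) (s.tab .adj) (s.var .x)).Dispenses (row (s.var .n) (s.tab .adj) (s.var .y))
        (row (s.var .n) (s.tab .adj) (s.var .z)) ∧ p = s.var .x ∧ q = s.var .y)) ∧
    (testVertex.run s).2 ≤ 100 + 50 * s.tab .deg (s.var .z) 0 := by
  simp only [testVertex, block, Cmd.run_seq, Cmd.run_set, Cmd.run_skip]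
  generalize ht : Mem.setVar (Mem.setVar (Mem.setVar s _ _) _ _) _ _ = t
  have hv : ∀ u', u' ≠ .cxz → u' ≠ .cyz → u' ≠ .cxyz → t.var u' = s.var u' := by
    intro u' h1 h2 h3
    subst ht
    simp [Mem.setVar, h1, h2, h3]
  have htab : t.tab = s.tab := by subst ht; rfl
  have h0 : t.var .cxz = 0 ∧ t.var .cyz = 0 ∧ t.var .cxyz = 0 := by
    subst ht
    simp [Mem.setVar, Expr.eval]
  obtain ⟨⟨h1, h2, h3⟩, h4⟩ := countNeighbours_spec t
  have hv' : ∀ u', countNeighbours.writesVar u' = false →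
      (countNeighbours.run t).1.var u' = t.var u' := fun _ h => Cmd.run_var_of_not_writesVar h t
  have ht' : ∀ A, (countNeighbours.run t).1.tab A = s.tab A :=
    fun A => (Cmd.run_tab_of_not_writesTab (by cases A <;> rfl) t).trans (by rw [htab])
  generalize countNeighbours.run t = r at *
  rw [h0.1, zero_add, htab, hv .z (by simp) (by simp) (by simp),
    hv .x (by simp) (by simp) (by simp), hrows.countP hz] at h1
  rw [h0.2.1, zero_add, htab, hv .z (by simp) (by simp) (by simp),
    hv .y (by simp) (by simp) (by simp), hrows.countP hz] at h2
  rw [h0.2.2, zero_add, htab, hv .z (by simp) (by simp) (by simp),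
    hv .x (by simp) (by simp) (by simp), hv .y (by simp) (by simp) (by simp),
    hrows.countP hz] at h3
  rw [htab, hv .z (by simp) (by simp) (by simp)] at h4
  have rx : r.1.var .x = s.var .x :=
    (hv' .x rfl).trans (hv .x (by simp) (by simp) (by simp))
  have ry : r.1.var .y = s.var .y :=
    (hv' .y rfl).trans (hv .y (by simp) (by simp) (by simp))
  have rz : r.1.var .z = s.var .z :=
    (hv' .z rfl).trans (hv .z (by simp) (by simp) (by simp))
  have rxy : r.1.var .cxy = s.var .cxy :=
    (hv' .cxy rfl).trans (hv .cxy (by simp) (by simp) (by simp))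
  -- All counters and all `deg` entries are now cardinalities of intersections and rows, so the test
  -- reads off the right-hand side of `Set.dispenses_iff_ncard`.
  have key : dispensabilityTest.eval r.1 = true ↔
      (row (s.var .n) (s.tab .adj) (s.var .x)).Dispenses (row (s.var .n) (s.tab .adj) (s.var .y))
        (row (s.var .n) (s.tab .adj) (s.var .z)) := by
    rw [Set.dispenses_iff_ncard (row_finite ..) (row_finite ..) (row_finite ..)]
    have e1 : r.1.var .cxz = (row (s.var .n) (s.tab .adj) (s.var .x) ∩
        row (s.var .n) (s.tab .adj) (s.var .z)).ncard := by
      rw [h1]; congr 1; ext v; simp [row]; tauto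
    have e2 : r.1.var .cyz = (row (s.var .n) (s.tab .adj) (s.var .y) ∩
        row (s.var .n) (s.tab .adj) (s.var .z)).ncard := by
      rw [h2]; congr 1; ext v; simp [row]; tauto
    have e3 : r.1.var .cxyz = (row (s.var .n) (s.tab .adj) (s.var .x) ∩
        row (s.var .n) (s.tab .adj) (s.var .y) ∩
        row (s.var .n) (s.tab .adj) (s.var .z)).ncard := by
      rw [h3]; congr 1; ext v; simp [row]; tauto
    simp only [dispensabilityTest, Test.eval, Expr.eval, e1, e2, e3, rx, ry, rz, rxy, hxy, ht',
      hrows.deg_eq hx, hrows.deg_eq hy, hrows.deg_eq hz, Bool.and_eq_true, Bool.or_eq_true,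
      beq_iff_eq, decide_eq_true_eq]
  refine ⟨fun p q => ?_, ?_⟩
  · rw [Cmd.run_cond, ← key, ← ht' .disp]
    by_cases hd : dispensabilityTest.eval r.1 = true
    · simp only [hd, if_true, Cmd.run_put, Mem.setTab, true_and, Expr.eval, rx, ry]
      split_ifs <;> tauto
    · simp [hd]
  · rw [Cmd.run_cond]
    split_ifs <;> simp [Cmd.run_put, Expr.cost, Test.cost, dispensabilityTest] <;> omega

theorem testPair_spec (s : Mem) (hrows : s.ListsRows) (hx : s.var .x < s.var .n)
    (hy : s.var .y < s.var .n) :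
    (∀ p q, (testPair.run s).1.tab .disp p q = 1 ↔ s.tab .disp p q = 1 ∨
      ((∃ z < s.var .n, (row (s.var .n) (s.tab .adj) (s.var .x)).Dispenses
        (row (s.var .n) (s.tab .adj) (s.var .y)) (row (s.var .n) (s.tab .adj) z)) ∧
        p = s.var .x ∧ q = s.var .y)) ∧
    (testPair.run s).2 ≤ 10 + 122 * s.var .n +
      50 * ∑ z ∈ Finset.range (s.var .n), s.tab .deg z 0 := by
  simp only [testPair, block, Cmd.run_seq, Cmd.run_set, Cmd.run_skip]
  generalize ht : Mem.setVar s _ _ = t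
  have hv : ∀ u', u' ≠ .cxy → t.var u' = s.var u' := by
    intro u' h1
    subst ht
    simp [Mem.setVar, h1]
  have htab : t.tab = s.tab := by subst ht; rfl
  have h0 : t.var .cxy = 0 := by
    subst ht
    simp [Mem.setVar, Expr.eval]
  obtain ⟨h1, h2⟩ := countCommon_spec t
  have rn := (Cmd.run_var_of_not_writesVar (c := countCommon) (u' := .n) rfl t).trans
    (hv .n (by simp))
  have rx := (Cmd.run_var_of_not_writesVar (c := countCommon) (u' := .x) rfl t).trans
    (hv .x (by simp))
  have ry := (Cmd.run_var_of_not_writesVar (c := countCommon) (u' := .y) rfl t).trans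
    (hv .y (by simp))
  have ht' : ∀ A, (countCommon.run t).1.tab A = s.tab A :=
    fun A => (Cmd.run_tab_of_not_writesTab (by cases A <;> rfl) t).trans (by rw [htab])
  rw [h0, zero_add, htab, hv .n (by simp), hv .x (by simp), hv .y (by simp)] at h1
  rw [hv .n (by simp)] at h2
  generalize countCommon.run t = r at *
  obtain ⟨m1, m2⟩ := Cmd.run_loop_induction (u := .z) (a := .var .n) (c := testVertex) (s := r.1)
    (fun v t => ∀ p q, t.tab .disp p q = 1 ↔ s.tab .disp p q = 1 ∨
      ∃ z < v, (row (s.var .n) (s.tab .adj) (s.var .x)).Dispenses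
        (row (s.var .n) (s.tab .adj) (s.var .y)) (row (s.var .n) (s.tab .adj) z) ∧
        p = s.var .x ∧ q = s.var .y)
    (fun z => 100 + 50 * s.tab .deg z 0) (by simp [ht']) (by
    intro v hlt q hvar htab' hI
    have qn : q.var .n = s.var .n := (hvar .n rfl).trans rn
    have qx : q.var .x = s.var .x := (hvar .x rfl).trans rx
    have qy : q.var .y = s.var .y := (hvar .y rfl).trans ry
    have qxy := (hvar .cxy rfl).trans h1
    have qadj : q.tab .adj = s.tab .adj := (htab' .adj rfl).trans (ht' _)
    have qdeg : q.tab .deg = s.tab .deg := (htab' .deg rfl).trans (ht' _)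
    have qnb : q.tab .nb = s.tab .nb := (htab' .nb rfl).trans (ht' _)
    have hrows' : (q.setVar .z v).ListsRows := hrows.congr (by simpa [Mem.setVar]) qdeg qnb qadj
    rw [Expr.eval, rn] at hlt
    obtain ⟨k1, k2⟩ := testVertex_spec (q.setVar .z v) hrows' (by simpa [Mem.setVar, qn, qx])
      (by simpa [Mem.setVar, qn, qy]) (by simpa [Mem.setVar, qn])
      (by simpa [Mem.setVar, qn, qx, qy, qadj])
    simp only [Mem.setVar, reduceCtorEq, if_false, if_true, qn, qx, qy, qadj, qdeg] at k1 k2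
    refine ⟨fun a b => ?_, k2⟩
    rw [Nat.exists_lt_succ_right, ← or_assoc, ← hI a b]
    exact k1 a b)
  simp only [Expr.eval, rn] at m1 m2
  refine ⟨fun p q => ?_, ?_⟩
  · rw [m1]
    grind
  · simp only [Finset.sum_add_distrib, Finset.sum_const, Finset.card_range, smul_eq_mul,
      ← Finset.mul_sum, Expr.cost] at m2 ⊢
    omega

/-- Only the adjacent pairs pay for `testPair`. There are `∑ deg[z]` of them (the diagonal
included), which gives the product; all `n²` pairs pay only for the adjacency test. -/
theorem markDispensable_spec (s : Mem) (hrows : s.ListsRows) :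
    (∀ p q, (markDispensable.run s).1.tab .disp p q = 1 ↔ s.tab .disp p q = 1 ∨
      (p < s.var .n ∧ q < s.var .n ∧ s.tab .adj p q = 1 ∧ p ≠ q ∧
        ∃ z < s.var .n, (row (s.var .n) (s.tab .adj) p).Dispenses
          (row (s.var .n) (s.tab .adj) q) (row (s.var .n) (s.tab .adj) z))) ∧
    (markDispensable.run s).2 ≤ 2 + 4 * s.var .n + 20 * s.var .n ^ 2 +
      (∑ z ∈ Finset.range (s.var .n), s.tab .deg z 0) *
        (10 + 122 * s.var .n + 50 * ∑ z ∈ Finset.range (s.var .n), s.tab .deg z 0) := by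
  generalize hT : 10 + 122 * s.var .n + 50 * ∑ z ∈ Finset.range (s.var .n), s.tab .deg z 0 = T
  have hrow : ∀ t : Mem, t.var .n = s.var .n → t.tab .deg = s.tab .deg → t.tab .nb = s.tab .nb →
      t.tab .adj = s.tab .adj → t.var .x < s.var .n → _ := fun s' hn hdeg hnb hadj hx =>
    Cmd.run_loop_induction (u := .y) (a := .var .n)
    (c := .cond (.and (flag .adj .x .y) (.not (.eq (.var .x) (.var .y)))) testPair) (s := s')
    (fun v t => ∀ p q, t.tab .disp p q = 1 ↔ s'.tab .disp p q = 1 ∨ ∃ y < v,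
      s.tab .adj (s'.var .x) y = 1 ∧ s'.var .x ≠ y ∧
      (∃ z < s.var .n, (row (s.var .n) (s.tab .adj) (s'.var .x)).Dispenses
        (row (s.var .n) (s.tab .adj) y) (row (s.var .n) (s.tab .adj) z)) ∧
        p = s'.var .x ∧ q = y)
    -- A constant for evaluating the test, and the full price `T` at every marked entry. The
    -- diagonal entry is charged as well, though its pair is skipped, so that the charges add up to
    -- `deg[x] * T`.
    (fun y => 16 + if s.tab .adj (s'.var .x) y = 1 then T else 0) (by simp) (by
    intro v hlt q hvar htab hI
    have qn : q.var .n = s.var .n := (hvar .n rfl).trans hn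
    have qx : q.var .x = s'.var .x := hvar .x rfl
    have qadj : q.tab .adj = s.tab .adj := (htab .adj rfl).trans hadj
    have qdeg : q.tab .deg = s.tab .deg := (htab .deg rfl).trans hdeg
    have qnb : q.tab .nb = s.tab .nb := (htab .nb rfl).trans hnb
    have hrows' : (q.setVar .y v).ListsRows := hrows.congr (by simpa [Mem.setVar]) qdeg qnb qadj
    rw [Expr.eval, hn] at hlt
    obtain ⟨k1, k2⟩ := testPair_spec (q.setVar .y v) hrows' (by simpa [Mem.setVar, qn, qx])
      (by simpa [Mem.setVar, qn])
    have ev : (Test.and (flag .adj .x .y) (.not (.eq (.var .x) (.var .y)))).eval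
        (q.setVar .y v) = true ↔ s.tab .adj (s'.var .x) v = 1 ∧ s'.var .x ≠ v := by
      simp [Test.eval, Expr.eval, Mem.setVar, qadj, qx]
    rw [Cmd.run_cond]
    generalize (testPair.run (q.setVar .y v)) = r at *
    simp only [Mem.setVar, reduceCtorEq, if_false, if_true, qn, qx, qadj, qdeg, hT] at k1 k2
    refine ⟨fun a b => ?_, ?_⟩
    · rw [Nat.exists_lt_succ_right, ← or_assoc, ← hI a b]
      split_ifs with h
      · have h' := ev.1 h
        simp only [k1, h'.1, true_and, ne_eq, h'.2, not_false_eq_true]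
      · rw [ev] at h
        simp only [Mem.setVar]
        tauto
    · split_ifs with h h' h'
      · simp [Test.cost, Expr.cost]
        omega
      · exact absurd (ev.1 h).1 h'
      · simp [Test.cost, Expr.cost]
        omega
      · simp [Test.cost, Expr.cost])
  obtain ⟨h1, h2⟩ := Cmd.run_loop_induction (u := .x) (a := .var .n)
    (c := .loop .y (.var .n)
      (.cond (.and (flag .adj .x .y) (.not (.eq (.var .x) (.var .y)))) testPair)) (s := s)
    (fun v t => ∀ p q, t.tab .disp p q = 1 ↔ s.tab .disp p q = 1 ∨
      ∃ x < v, ∃ y < s.var .n, s.tab .adj x y = 1 ∧ x ≠ y ∧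
      (∃ z < s.var .n, (row (s.var .n) (s.tab .adj) x).Dispenses
        (row (s.var .n) (s.tab .adj) y) (row (s.var .n) (s.tab .adj) z)) ∧ p = x ∧ q = y)
    (fun x => 2 + 18 * s.var .n + s.tab .deg x 0 * T) (by simp) (by
    intro v hlt q hvar htab hI
    rw [Expr.eval] at hlt
    have qn : (q.setVar .x v).var .n = s.var .n := hvar .n rfl
    obtain ⟨k1, k2⟩ := hrow (q.setVar .x v) qn (htab .deg rfl)
      (htab .nb rfl) (htab .adj rfl) (by simpa [Mem.setVar] using hlt)
    simp only [Expr.eval, qn] at k1 k2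
    simp only [Mem.setVar, if_true] at k1 k2
    refine ⟨fun a b => ?_, k2.trans ?_⟩
    · rw [Nat.exists_lt_succ_right, ← or_assoc, ← hI a b]
      exact k1 a b
    · have hd : s.tab .deg v 0 =
          ((Finset.range (s.var .n)).filter (s.tab .adj v · = 1)).card := by
        rw [hrows.deg_eq hlt, ← Set.ncard_coe_finset]
        congr 1
        ext
        simp [row]
      simp only [Finset.sum_add_distrib, Finset.sum_const, Finset.card_range, smul_eq_mul,
        Expr.cost, ← Finset.sum_filter, ← hd]
      omega)
  refine ⟨fun p q => (h1 p q).trans (or_congr_right ⟨?_, ?_⟩), h2.trans ?_⟩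
  · rintro ⟨x, hx, y, hy, h3, h4, h5, rfl, rfl⟩
    exact ⟨hx, hy, h3, h4, h5⟩
  · rintro ⟨hx, hy, h3, h4, h5⟩
    exact ⟨p, hx, q, hy, h3, h4, h5, rfl, rfl⟩
  · simp only [Finset.sum_add_distrib, Finset.sum_const, Finset.card_range, smul_eq_mul,
      ← Finset.sum_mul, Expr.cost, Expr.eval]
    nlinarith

/-! ### Deleting edges -/

/-- The part of `deleteEdges` for one edge `{x, y}` of the 2-section. -/
def deleteContaining : Cmd :=
  .loop .e (.var .m) (.cond (.and (flag .inc .e .x) (flag .inc .e .y))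
    (.put .alive (.var .e) (.const 0) (.const 0)))

theorem deleteContaining_spec (s : Mem) :
    (∀ p, (deleteContaining.run s).1.tab .alive p 0 = 1 ↔ s.tab .alive p 0 = 1 ∧
      ¬ (p < s.var .m ∧ s.tab .inc p (s.var .x) = 1 ∧ s.tab .inc p (s.var .y) = 1)) ∧
    (deleteContaining.run s).2 ≤ 2 + 20 * s.var .m := by
  obtain ⟨h1, h2⟩ := Cmd.run_loop_induction (u := .e) (a := .var .m)
    (c := .cond (.and (flag .inc .e .x) (flag .inc .e .y))
      (.put .alive (.var .e) (.const 0) (.const 0))) (s := s)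
    (fun v t => ∀ p, t.tab .alive p 0 = 1 ↔ s.tab .alive p 0 = 1 ∧
      ¬ (p < v ∧ s.tab .inc p (s.var .x) = 1 ∧ s.tab .inc p (s.var .y) = 1))
    (fun _ => 18) (by simp) (by
    intro v _ t hvar htab hI
    have hx := hvar .x rfl
    have hy := hvar .y rfl
    have hinc := htab .inc rfl
    have ev : (Test.and (flag .inc .e .x) (flag .inc .e .y)).eval (t.setVar .e v) = true ↔
        s.tab .inc v (s.var .x) = 1 ∧ s.tab .inc v (s.var .y) = 1 := by
      simp [Test.eval, Expr.eval, Mem.setVar, hinc, hx, hy]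
    rw [Cmd.run_cond]
    refine ⟨fun p => ?_, ?_⟩
    · have := hI p
      split_ifs with h
      · rw [ev] at h
        by_cases hp : p = v
        · subst hp
          simp [Cmd.run_put, Mem.setTab, Mem.setVar, Expr.eval, h]
        · simp only [Cmd.run_put, Mem.setTab, Mem.setVar, Expr.eval, if_true, hp, false_and,
            and_false, if_false, this, Nat.lt_succ_iff_lt_or_eq, or_false]
      · rw [ev] at h
        simp only [Mem.setVar, this, Nat.lt_succ_iff_lt_or_eq]
        grind
    · split_ifs <;> simp [Cmd.run_put, Test.cost, Expr.cost])
  refine ⟨h1, h2.trans ?_⟩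
  simp [Expr.eval, Expr.cost]
  omega

/-- `D` bounds the number of marked ordered pairs, each of which costs one scan over all edges. -/
theorem deleteEdges_spec (s : Mem) (D : ℕ) (hD : ∑ x ∈ Finset.range (s.var .n),
      ((Finset.range (s.var .n)).filter (s.tab .disp x · = 1)).card ≤ D) :
    (∀ p, (deleteEdges.run s).1.tab .alive p 0 = 1 ↔ s.tab .alive p 0 = 1 ∧
      ¬ ∃ x < s.var .n, ∃ y < s.var .n, s.tab .disp x y = 1 ∧
        p < s.var .m ∧ s.tab .inc p x = 1 ∧ s.tab .inc p y = 1) ∧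
    (deleteEdges.run s).2 ≤ 2 + 4 * s.var .n + 20 * s.var .n ^ 2 + D * (2 + 20 * s.var .m) := by
  have hrow : ∀ t : Mem, t.var .n = s.var .n → t.var .m = s.var .m → t.tab .inc = s.tab .inc →
      t.tab .disp = s.tab .disp → _ := fun s' hn hm hinc hdisp =>
    Cmd.run_loop_induction (u := .y) (a := .var .n)
    (c := .cond (flag .disp .x .y) deleteContaining) (s := s')
    (fun v t => ∀ p, t.tab .alive p 0 = 1 ↔ s'.tab .alive p 0 = 1 ∧
      ¬ ∃ y < v, s.tab .disp (s'.var .x) y = 1 ∧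
        p < s.var .m ∧ s.tab .inc p (s'.var .x) = 1 ∧ s.tab .inc p y = 1)
    (fun y => 16 + if s.tab .disp (s'.var .x) y = 1 then 2 + 20 * s.var .m else 0) (by simp) (by
    intro v hlt q hvar htab hI
    have qn : q.var .n = s.var .n := (hvar .n rfl).trans hn
    have qm : q.var .m = s.var .m := (hvar .m rfl).trans hm
    have qx : q.var .x = s'.var .x := hvar .x rfl
    have qinc : q.tab .inc = s.tab .inc := (htab .inc rfl).trans hinc
    have qdisp : q.tab .disp = s.tab .disp := (htab .disp rfl).trans hdisp
    obtain ⟨k1, k2⟩ := deleteContaining_spec (q.setVar .y v)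
    have ev : (flag .disp .x .y).eval (q.setVar .y v) = true ↔
        s.tab .disp (s'.var .x) v = 1 := by
      simp [Test.eval, Expr.eval, Mem.setVar, qdisp, qx]
    rw [Cmd.run_cond]
    generalize (deleteContaining.run (q.setVar .y v)) = r at *
    simp only [Mem.setVar, reduceCtorEq, if_false, if_true, qm, qx, qinc] at k1 k2
    refine ⟨fun a => ?_, ?_⟩
    · rw [Nat.exists_lt_succ_right, not_or, ← and_assoc, ← hI a]
      split_ifs with h
      · have h' := ev.1 h
        simp only [k1, h', true_and]
      · rw [ev] at h
        simp only [Mem.setVar]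
        tauto
    · split_ifs with h h' h'
      · simp [Test.cost, Expr.cost]
        omega
      · exact absurd (ev.1 h) h'
      · simp [Test.cost, Expr.cost]
        omega
      · simp [Test.cost, Expr.cost])
  obtain ⟨h1, h2⟩ := Cmd.run_loop_induction (u := .x) (a := .var .n)
    (c := .loop .y (.var .n) (.cond (flag .disp .x .y) deleteContaining)) (s := s)
    (fun v t => ∀ p, t.tab .alive p 0 = 1 ↔ s.tab .alive p 0 = 1 ∧
      ¬ ∃ x < v, ∃ y < s.var .n, s.tab .disp x y = 1 ∧
        p < s.var .m ∧ s.tab .inc p x = 1 ∧ s.tab .inc p y = 1)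
    (fun x => 2 + 18 * s.var .n + ((Finset.range (s.var .n)).filter
      (s.tab .disp x · = 1)).card * (2 + 20 * s.var .m)) (by simp) (by
    intro v hlt q hvar htab hI
    have qn : (q.setVar .x v).var .n = s.var .n := hvar .n rfl
    obtain ⟨k1, k2⟩ := hrow (q.setVar .x v) qn (hvar .m rfl)
      (htab .inc rfl) (htab .disp rfl)
    simp only [Expr.eval, qn] at k1 k2
    simp only [Mem.setVar, if_true] at k1 k2
    refine ⟨fun a => ?_, k2.trans ?_⟩
    · rw [Nat.exists_lt_succ_right, not_or, ← and_assoc, ← hI a]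
      exact k1 a
    · rw [Finset.sum_add_distrib, Finset.sum_add_distrib, ← Finset.sum_filter]
      simp only [Finset.sum_const, Finset.card_range, smul_eq_mul, Expr.cost]
      omega)
  refine ⟨h1, h2.trans ?_⟩
  simp only [Finset.sum_add_distrib, Finset.sum_const, Finset.card_range, smul_eq_mul,
    ← Finset.sum_mul, Expr.cost, Expr.eval]
  nlinarith [Nat.mul_le_mul_right (2 + 20 * s.var .m) hD]

end SkeletonRAM

namespace SkeletonRAM

/-! ### The algorithm on its input -/

section
variable (n : ℕ) (K : List (List ℕ))

/-- Adjacency or equality of the vertices `p`, `q < n`, for the edges listed in `K`. -/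
def Near (p q : ℕ) : Prop := (p < n ∧ p = q) ∨ ∃ l ∈ K, p ∈ l ∧ q ∈ l

/-- The closed neighbourhood of `p` in the hypergraph with the edges listed in `K`. -/
def closedNbhd (p : ℕ) : Set ℕ := {q | q < n ∧ Near n K p q}

/-- `{p, q}` is a dispensable edge of the 2-section of the hypergraph listed in `K`. -/
def DispensablePair (p q : ℕ) : Prop :=
  p < n ∧ q < n ∧ Near n K p q ∧ p ≠ q ∧
    ∃ z < n, (closedNbhd n K p).Dispenses (closedNbhd n K q) (closedNbhd n K z)

theorem exists_getD_iff (l : List ℕ) (q : ℕ) : (∃ i < l.length, q = l.getD i 0) ↔ q ∈ l := by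
  rw [List.mem_iff_getElem]
  constructor
  · rintro ⟨i, hi, rfl⟩
    exact ⟨i, hi, by simp [hi]⟩
  · rintro ⟨i, hi, rfl⟩
    exact ⟨i, hi, by simp [hi]⟩

theorem exists_lt_getD_iff (P : List ℕ → Prop) :
    (∃ e < K.length, P (K.getD e [])) ↔ ∃ l ∈ K, P l := by
  constructor
  · rintro ⟨e, he, h⟩
    exact ⟨K[e], List.getElem_mem he, by simpa [he] using h⟩
  · rintro ⟨l, hl, h⟩
    obtain ⟨e, he, rfl⟩ := List.mem_iff_getElem.1 hl
    exact ⟨e, he, by simpa [he] using h⟩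

theorem buildTwoSection_load :
    (∀ p q, (buildTwoSection.run (load n K)).1.tab .adj p q = 1 ↔ Near n K p q) ∧
    (∀ p q, (buildTwoSection.run (load n K)).1.tab .inc p q = 1 ↔
      p < K.length ∧ q ∈ K.getD p []) ∧
    (buildTwoSection.run (load n K)).2 ≤ 4 + 6 * n +
      ∑ e ∈ Finset.range K.length,
        (6 + 14 * (K.getD e []).length + 8 * (K.getD e []).length ^ 2) := by
  obtain ⟨h1, h2, h3⟩ := buildTwoSection_spec (load n K)
  simp only [load, if_true] at h1 h2 h3
  refine ⟨fun p q => (h1 p q).trans ?_, fun p q => (h2 p q).trans ?_, h3⟩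
  · rw [Near, ← exists_lt_getD_iff K fun l => p ∈ l ∧ q ∈ l]
    simp only [← exists_getD_iff _ p, ← exists_getD_iff _ q, zero_ne_one, false_or]
    grind
  · rw [← exists_getD_iff]
    simp

/-- The sum of the sizes of the closed neighbourhoods. -/
noncomputable def nbhdSum : ℕ := ∑ z ∈ Finset.range n, (closedNbhd n K z).ncard

theorem computeDispensable_load :
    (∀ p q, (computeDispensable.run (load n K)).1.tab .disp p q = 1 ↔ DispensablePair n K p q) ∧
    (∀ p q, (computeDispensable.run (load n K)).1.tab .inc p q = 1 ↔
      p < K.length ∧ q ∈ K.getD p []) ∧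
    (computeDispensable.run (load n K)).2 ≤ (4 + 6 * n +
      ∑ e ∈ Finset.range K.length,
        (6 + 14 * (K.getD e []).length + 8 * (K.getD e []).length ^ 2)) +
      (2 + 4 * n + 22 * n ^ 2) + (2 + 4 * n + 20 * n ^ 2 +
      nbhdSum n K * (10 + 122 * n + 50 * nbhdSum n K)) := by
  obtain ⟨a1, a2, a3⟩ := buildTwoSection_load n K
  have fv : ∀ u', u' = .n → (buildTwoSection.run (load n K)).1.var u' = n := by
    rintro u' rfl
    exact Cmd.run_var_of_not_writesVar rfl _
  have fdeg : (buildTwoSection.run (load n K)).1.tab .deg = (load n K).tab .deg :=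
    Cmd.run_tab_of_not_writesTab rfl _
  have fdisp : (buildTwoSection.run (load n K)).1.tab .disp = (load n K).tab .disp :=
    Cmd.run_tab_of_not_writesTab rfl _
  simp only [computeDispensable, block, Cmd.run_seq, Cmd.run_skip]
  generalize buildTwoSection.run (load n K) = r at *
  obtain ⟨b1, b2⟩ := buildNeighbourLists_spec r.1 (by intro p; rw [fdeg]; rfl)
  have gn : (buildNeighbourLists.run r.1).1.var .n = n :=
    (Cmd.run_var_of_not_writesVar rfl _).trans (fv _ rfl)
  have gadj : (buildNeighbourLists.run r.1).1.tab .adj = r.1.tab .adj :=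
    Cmd.run_tab_of_not_writesTab rfl _
  have ginc : (buildNeighbourLists.run r.1).1.tab .inc = r.1.tab .inc :=
    Cmd.run_tab_of_not_writesTab rfl _
  have gdisp : (buildNeighbourLists.run r.1).1.tab .disp = r.1.tab .disp :=
    Cmd.run_tab_of_not_writesTab rfl _
  generalize buildNeighbourLists.run r.1 = t at *
  have hrows : t.1.ListsRows := by simpa only [Mem.ListsRows, gn, gadj, fv _ rfl] using b1
  obtain ⟨c1, c2⟩ := markDispensable_spec t.1 hrows
  have kinc : (markDispensable.run t.1).1.tab .inc = t.1.tab .inc :=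
    Cmd.run_tab_of_not_writesTab rfl _
  have hrow : ∀ x, row n (r.1.tab .adj) x = closedNbhd n K x := fun x => by
    ext v
    simp [row, closedNbhd, a1]
  have hsum : ∑ z ∈ Finset.range n, t.1.tab .deg z 0 = nbhdSum n K := by
    refine Finset.sum_congr rfl fun z hz => ?_
    rw [hrows.deg_eq (by simpa [gn] using hz), gn, gadj, hrow]
  simp only [gn, hsum, gadj, hrow, a1, gdisp, fdisp] at c1 c2
  refine ⟨fun p q => (c1 p q).trans ?_, fun p q => ?_, ?_⟩
  · simp [load, DispensablePair]
  · rw [kinc, ginc, a2]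
  · rw [fv _ rfl] at b2
    omega

theorem cartesianSkeletonAlgorithm_load :
    (∀ p, (cartesianSkeletonAlgorithm.run (load n K)).1.tab .alive p 0 = 1 ↔ p < K.length ∧
      ¬ ∃ x ∈ K.getD p [], ∃ y ∈ K.getD p [], DispensablePair n K x y) ∧
    (cartesianSkeletonAlgorithm.run (load n K)).2 ≤ ((4 + 6 * n +
      ∑ e ∈ Finset.range K.length,
        (6 + 14 * (K.getD e []).length + 8 * (K.getD e []).length ^ 2)) +
      (2 + 4 * n + 22 * n ^ 2) + (2 + 4 * n + 20 * n ^ 2 +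
      nbhdSum n K * (10 + 122 * n + 50 * nbhdSum n K))) +
      (2 + 4 * n + 20 * n ^ 2 + nbhdSum n K * (2 + 20 * K.length)) := by
  obtain ⟨a1, a2, a3⟩ := computeDispensable_load n K
  have fn : (computeDispensable.run (load n K)).1.var .n = n :=
    Cmd.run_var_of_not_writesVar rfl _
  have fm : (computeDispensable.run (load n K)).1.var .m = K.length :=
    Cmd.run_var_of_not_writesVar rfl _
  have falive : (computeDispensable.run (load n K)).1.tab .alive = (load n K).tab .alive :=
    Cmd.run_tab_of_not_writesTab rfl _
  simp only [cartesianSkeletonAlgorithm, Cmd.run_seq]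
  generalize computeDispensable.run (load n K) = r at *
  -- Marked pairs are adjacent, so those with first entry `x` number at most `|N[x]|`.
  obtain ⟨b1, b2⟩ := deleteEdges_spec r.1 (nbhdSum n K) (by
    rw [fn]
    refine Finset.sum_le_sum fun x _ => ?_
    rw [← Set.ncard_coe_finset]
    refine Set.ncard_le_ncard (fun y hy => ?_) ((Set.finite_lt_nat n).subset fun _ h => h.1)
    simp only [Finset.coe_filter, Set.mem_ofPred_eq, a1] at hy
    exact ⟨hy.2.2.1, hy.2.2.2.1⟩)
  rw [fn, fm] at b2
  refine ⟨fun p => (b1 p).trans ?_, by omega⟩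
  simp only [fn, fm, a1, a2, falive]
  simp only [load, true_and, ite_eq_left_iff, zero_ne_one, imp_false, not_not]
  refine and_congr_right fun hp => not_congr ⟨?_, ?_⟩
  · rintro ⟨x, -, y, -, h, -, ⟨-, h1⟩, -, h2⟩
    exact ⟨x, h1, y, h2, h⟩
  · rintro ⟨x, h1, y, h2, h⟩
    exact ⟨x, h.1, y, h.2.1, h, hp, ⟨hp, h1⟩, hp, h2⟩

/-- Double counting: a pair with `q ∈ N[p]` is either diagonal or lies in `l × l` for a listed edge
`l`, and each such square has at most `r²` elements. -/
theorem nbhdSum_le {r : ℕ} (hr : ∀ l ∈ K, l.length ≤ r) : nbhdSum n K ≤ n + K.length * r ^ 2 := by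
  classical
  have h1 : nbhdSum n K = ((Finset.range n ×ˢ Finset.range n).filter
      fun p => Near n K p.1 p.2).card := by
    rw [Finset.card_filter, Finset.sum_product]
    refine Finset.sum_congr rfl fun x _ => ?_
    rw [← Finset.card_filter, ← Set.ncard_coe_finset]
    congr 1
    ext
    simp [closedNbhd]
  have h2 : ((Finset.range n ×ˢ Finset.range n).filter fun p => Near n K p.1 p.2) ⊆
      (Finset.range n).image (fun x => (x, x)) ∪
        K.toFinset.biUnion fun l => l.toFinset ×ˢ l.toFinset := by
    rintro ⟨p, q⟩ h
    rw [Finset.mem_filter, Finset.mem_product, Finset.mem_range, Near] at h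
    dsimp only at h
    simp only [Finset.mem_union, Finset.mem_image, Finset.mem_biUnion, Finset.mem_range,
      List.mem_toFinset, Finset.mem_product, Prod.mk.injEq]
    rcases h.2 with ⟨_, rfl⟩ | h
    · exact .inl ⟨p, h.1.1, rfl, rfl⟩
    · exact .inr h
  rw [h1]
  refine (Finset.card_le_card h2).trans ((Finset.card_union_le _ _).trans (add_le_add ?_ ?_))
  · exact Finset.card_image_le.trans (Finset.card_range n).le
  · refine (Finset.card_biUnion_le_card_mul _ _ (r ^ 2) fun l hl => ?_).trans
      (Nat.mul_le_mul_right _ (List.toFinset_card_le K))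
    have := (List.toFinset_card_le l).trans (hr l (List.mem_toFinset.1 hl))
    rw [Finset.card_product, sq]
    exact Nat.mul_le_mul this this

/-- With `nbhdSum ≤ 2X` every term is at most a multiple of `X²`; `700` exceeds the sum of the
coefficients with some slack. -/
theorem cartesianSkeletonAlgorithm_cost {r X : ℕ} (hr : ∀ l ∈ K, l.length ≤ r) (hX : 1 ≤ X)
    (hn : n ≤ X) (hm : K.length ≤ X) (hmr : K.length * r ^ 2 ≤ X) :
    (cartesianSkeletonAlgorithm.run (load n K)).2 ≤ 700 * X ^ 2 := by
  refine (cartesianSkeletonAlgorithm_load n K).2.trans ?_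
  have hD : nbhdSum n K ≤ 2 * X := (nbhdSum_le n K hr).trans (by omega)
  have hS : ∑ e ∈ Finset.range K.length,
      (6 + 14 * (K.getD e []).length + 8 * (K.getD e []).length ^ 2) ≤ 28 * X := by
    have : ∀ e ∈ Finset.range K.length,
        6 + 14 * (K.getD e []).length + 8 * (K.getD e []).length ^ 2 ≤ 6 + 22 * r ^ 2 := by
      intro e he
      have he' := Finset.mem_range.1 he
      have h1 : (K.getD e []).length ≤ r := by
        simpa [he'] using hr _ (List.getElem_mem he')
      have h2 := Nat.pow_le_pow_left h1 2
      have h3 : (K.getD e []).length ≤ (K.getD e []).length ^ 2 := Nat.le_self_pow two_ne_zero _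
      omega
    refine (Finset.sum_le_sum this).trans ?_
    rw [Finset.sum_const, Finset.card_range, smul_eq_mul]
    nlinarith
  have h1 : nbhdSum n K * (10 + 122 * n + 50 * nbhdSum n K) ≤
      2 * X * (10 + 122 * X + 50 * (2 * X)) := by gcongr
  have h2 : nbhdSum n K * (2 + 20 * K.length) ≤ 2 * X * (2 + 20 * X) := by gcongr
  have h3 : n ^ 2 ≤ X ^ 2 := Nat.pow_le_pow_left hn 2
  have h4 : X ≤ X ^ 2 := Nat.le_self_pow two_ne_zero _
  ring_nf at h1 h2 ⊢
  ring_nf at hS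
  nlinarith

end

end SkeletonRAM

namespace Hypergraph

/-! ### Hypergraphs, numberings and listings -/

variable {α : Type*} {H : Hypergraph α}

/-- `Adj` relates a vertex of an edge to itself, while 2-section edges need two distinct ends;
adding `v` to `N[v]` removes the difference. -/
theorem nbhd_twoSection (H : Hypergraph α) (v : α) : H.twoSection.nbhd v = H.nbhd v := by
  ext u
  simp only [nbhd, Set.mem_union, Set.mem_singleton_iff]
  constructor
  · rintro (⟨p, ⟨x, y, -, rfl, e, he, hp⟩, hv, hu⟩ | h)
    · exact .inl ⟨e, he, hp hv, hp hu⟩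
    · exact .inr h
  · rintro (⟨e, he, hv, hu⟩ | h)
    · by_cases huv : u = v
      · exact .inr huv
      · exact .inl ⟨{v, u}, ⟨v, u, Ne.symm huv, rfl, e, he, by grind⟩, by simp, by simp⟩
    · exact .inr h

theorem nbhd_subset {v : α} (hv : v ∈ H.vertexSet) : H.nbhd v ⊆ H.vertexSet := by
  rintro u (⟨e, he, hu, -⟩ | rfl)
  · exact H.subset_vertexSet_of_mem_edgeSet' he hu
  · exact hv

theorem isDispensable_iff {e : Set α} : H.IsDispensable e ↔ ∃ x ∈ e, ∃ y ∈ e, x ≠ y ∧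
    ∃ z ∈ H.vertexSet, (H.nbhd x).Dispenses (H.nbhd y) (H.nbhd z) := by
  constructor
  · rintro ⟨z, hz, x, hx, y, hy, hxy, h⟩
    exact ⟨x, hx, y, hy, hxy, z, hz, h⟩
  · rintro ⟨x, hx, y, hy, hxy, z, hz, h⟩
    exact ⟨z, hz, x, hx, y, hy, hxy, h⟩

/-- The pair is unordered, so a witness may name its ends in either order; `Set.Dispenses.symm`
absorbs the swap. -/
theorem pair_mem_dispensableEdges_twoSection {x y : α} :
    {x, y} ∈ H.twoSection.dispensableEdges ↔ x ≠ y ∧ H.Adj x y ∧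
      ∃ z ∈ H.vertexSet, (H.nbhd x).Dispenses (H.nbhd y) (H.nbhd z) := by
  simp only [dispensableEdges, Set.mem_ofPred_eq, isDispensable_iff, nbhd_twoSection]
  constructor
  · rintro ⟨⟨a, b, hab, h, e, he, hs⟩, a', ha', b', hb', hab', z, hz, hd⟩
    rw [← h] at hs
    have hadj : H.Adj x y := ⟨e, he, hs (by simp), hs (by simp)⟩
    rcases ha' with rfl | rfl <;> rcases hb' with rfl | rfl
    · exact absurd rfl hab'
    · exact ⟨hab', hadj, z, hz, hd⟩
    · exact ⟨hab'.symm, hadj, z, hz, hd.symm⟩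
    · exact absurd rfl hab'
  · rintro ⟨hxy, ⟨e, he, hx, hy⟩, z, hz, hd⟩
    exact ⟨⟨x, y, hxy, rfl, e, he, by grind⟩, x, by simp, y, by simp, hxy, z, hz, hd⟩

theorem edgeSet_finite (hV : H.vertexSet.Finite) : H.edgeSet.Finite :=
  hV.finite_subsets.subset fun _ he => H.subset_vertexSet_of_mem_edgeSet' he

theorem ncard_le_rank (hV : H.vertexSet.Finite) {e : Set α} (he : e ∈ H.edgeSet) :
    e.ncard ≤ H.rank :=
  le_csSup ((edgeSet_finite hV).image _).bddAbove ⟨e, he, rfl⟩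

theorem IsConnected.exists_mem_edge (hc : H.IsConnected) {u v : α} (hu : u ∈ H.vertexSet)
    (hv : v ∈ H.vertexSet) (huv : u ≠ v) : ∃ e ∈ H.edgeSet, u ∈ e := by
  rcases (hc u hu v hv).cases_head with h | ⟨w, ⟨e, he, hue, -⟩, -⟩
  · exact absurd h huv
  · exact ⟨e, he, hue⟩

end Hypergraph

theorem Set.Dispenses.image_iff {α β : Type*} {f : α → β} {V A B C : Set α}
    (hf : Set.InjOn f V) (hA : A ⊆ V) (hB : B ⊆ V) (hC : C ⊆ V) :
    (f '' A).Dispenses (f '' B) (f '' C) ↔ A.Dispenses B C := by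
  have hAB : A ∩ B ⊆ V := Set.inter_subset_left.trans hA
  have hAC : A ∩ C ⊆ V := Set.inter_subset_left.trans hA
  have hBC : B ∩ C ⊆ V := Set.inter_subset_left.trans hB
  simp only [Set.Dispenses, ← hf.image_inter hA hB, ← hf.image_inter hA hC,
    ← hf.image_inter hB hC, hf.image_ssubset_image_iff hAB hAC, hf.image_ssubset_image_iff hAB hBC,
    hf.image_ssubset_image_iff hA hC, hf.image_ssubset_image_iff hC hB,
    hf.image_ssubset_image_iff hB hC, hf.image_ssubset_image_iff hC hA]

theorem List.Nodup.ncard_setOf_mem {α : Type*} {l : List α} (h : l.Nodup) :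
    {v | v ∈ l}.ncard = l.length := by
  classical
  rw [← List.toFinset_card_of_nodup h, ← Set.ncard_coe_finset]
  simp

namespace Hypergraph

section
variable {α : Type*} {H : Hypergraph α} {L : List (List α)}

theorem IsListing.mem_edgeSet_iff (hL : H.IsListing L) {e : Set α} :
    e ∈ H.edgeSet ↔ ∃ l ∈ L, {v | v ∈ l} = e := by
  rw [← hL.2.2, List.mem_map]

theorem IsListing.mem_edgeSet (hL : H.IsListing L) {l : List α} (hl : l ∈ L) :
    {v | v ∈ l} ∈ H.edgeSet := hL.mem_edgeSet_iff.2 ⟨l, hl, rfl⟩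

theorem IsListing.length_eq (hL : H.IsListing L) : L.length = H.edgeSet.ncard := by
  rw [← List.length_map (as := L) fun l => {v | v ∈ l}, ← hL.2.1.ncard_setOf_mem]
  congr 1
  ext e
  exact hL.2.2 e

theorem IsListing.length_le_rank (hL : H.IsListing L) (hV : H.vertexSet.Finite) {l : List α}
    (hl : l ∈ L) : l.length ≤ H.rank := by
  rw [← (hL.1 l hl).ncard_setOf_mem]
  exact ncard_le_rank hV (hL.mem_edgeSet hl)

/-- A finite connected hypergraph has at most `max 1 (|E| r)` vertices. -/
theorem ncard_vertexSet_le (hV : H.vertexSet.Finite) (hs : H.IsSimple) (hc : H.IsConnected) :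
    H.vertexSet.ncard ≤ max 1 (H.edgeSet.ncard * H.rank) := by
  classical
  by_cases hE : H.edgeSet = ∅
  · refine le_max_of_le_left ((Set.ncard_le_one hV).2 fun u hu v hv => ?_)
    by_contra huv
    obtain ⟨e, he, -⟩ := hc.exists_mem_edge hu hv huv
    simp [hE] at he
  · refine le_max_of_le_right ?_
    obtain ⟨e, he⟩ := Set.nonempty_iff_ne_empty.2 hE
    have hcov : H.vertexSet ⊆ ⋃ f ∈ (edgeSet_finite hV).toFinset, f := by
      intro u hu
      -- As `|e| ≥ 2`, some vertex of `e` differs from `u`, and the first edge of a chain from `u`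
      -- to it contains `u`. So the edges cover `V`.
      obtain ⟨w, hw, hwu⟩ := Set.exists_ne_of_one_lt_ncard (hs.2 e he) u
      obtain ⟨f, hf, huf⟩ :=
        hc.exists_mem_edge hu (H.subset_vertexSet_of_mem_edgeSet' he hw) hwu.symm
      simp only [Set.Finite.mem_toFinset, Set.mem_iUnion]
      exact ⟨f, hf, huf⟩
    have hfin : (⋃ f ∈ (edgeSet_finite hV).toFinset, f).Finite := by
      refine hV.subset ?_
      simp only [Set.Finite.mem_toFinset, Set.iUnion_subset_iff]
      exact fun f hf => H.subset_vertexSet_of_mem_edgeSet' hf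
    refine (Set.ncard_le_ncard hcov hfin).trans ?_
    refine (Finset.set_ncard_biUnion_le _ _).trans ?_
    rw [Set.ncard_eq_toFinset_card _ (edgeSet_finite hV), ← smul_eq_mul]
    exact Finset.sum_le_card_nsmul _ _ _ fun f hf => ncard_le_rank hV (by simpa using hf)

end

end Hypergraph

/-! ### Transport along the numbering: correctness and running time. -/

namespace SkeletonRAM

open Hypergraph

variable {α : Type*} {H : Hypergraph α} {L : List (List α)} {num : α → ℕ}

theorem closedNbhd_num (hnum : Set.BijOn num H.vertexSet {v | v < H.vertexSet.ncard})
    (hL : H.IsListing L) {x : α} (hx : x ∈ H.vertexSet) :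
    closedNbhd H.vertexSet.ncard (L.map (List.map num)) (num x) = num '' H.nbhd x := by
  ext q
  constructor
  · rintro ⟨hq, h⟩
    obtain ⟨y, hy, rfl⟩ := hnum.surjOn hq
    refine ⟨y, ?_, rfl⟩
    rcases h with ⟨-, h⟩ | ⟨l, hl, h1, h2⟩
    · exact .inr (hnum.injOn hx hy h).symm
    · obtain ⟨l, hl', rfl⟩ := List.mem_map.1 hl
      have hsub := H.subset_vertexSet_of_mem_edgeSet' (hL.mem_edgeSet hl')
      obtain ⟨x', hx', h1⟩ := List.mem_map.1 h1
      obtain ⟨y', hy', h2⟩ := List.mem_map.1 h2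
      rw [hnum.injOn (hsub hx') hx h1] at hx'
      rw [hnum.injOn (hsub hy') hy h2] at hy'
      exact .inl ⟨_, hL.mem_edgeSet hl', hy', hx'⟩
  · rintro ⟨y, hy, rfl⟩
    refine ⟨hnum.mapsTo (nbhd_subset hx hy), ?_⟩
    rcases hy with ⟨e, he, h2, h1⟩ | rfl
    · obtain ⟨l, hl, rfl⟩ := hL.mem_edgeSet_iff.1 he
      exact .inr ⟨_, List.mem_map_of_mem hl, List.mem_map_of_mem h1, List.mem_map_of_mem h2⟩
    · exact .inl ⟨hnum.mapsTo hx, rfl⟩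

theorem dispensablePair_num (hnum : Set.BijOn num H.vertexSet {v | v < H.vertexSet.ncard})
    (hL : H.IsListing L) {x y : α} (hx : x ∈ H.vertexSet) (hy : y ∈ H.vertexSet) :
    DispensablePair H.vertexSet.ncard (L.map (List.map num)) (num x) (num y) ↔
      {x, y} ∈ H.twoSection.dispensableEdges := by
  have hnear : Near H.vertexSet.ncard (L.map (List.map num)) (num x) (num y) ↔ y ∈ H.nbhd x := by
    rw [← hnum.injOn.mem_image_iff (nbhd_subset hx) hy, ← closedNbhd_num hnum hL hx]
    exact (and_iff_right (hnum.mapsTo hy)).symm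
  rw [pair_mem_dispensableEdges_twoSection, DispensablePair, hnear, closedNbhd_num hnum hL hx,
    closedNbhd_num hnum hL hy]
  constructor
  · rintro ⟨-, -, hadj, hne, z, hz, hd⟩
    obtain ⟨z, hz', rfl⟩ := hnum.surjOn hz
    rw [closedNbhd_num hnum hL hz', Set.Dispenses.image_iff hnum.injOn (nbhd_subset hx)
      (nbhd_subset hy) (nbhd_subset hz')] at hd
    have hne' : x ≠ y := fun h => hne (by rw [h])
    exact ⟨hne', (hadj.resolve_right fun h => hne' h.symm).symm, z, hz', hd⟩
  · rintro ⟨hne, hadj, z, hz, hd⟩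
    refine ⟨hnum.mapsTo hx, hnum.mapsTo hy, .inl hadj.symm, fun h => hne (hnum.injOn hx hy h),
      num z, hnum.mapsTo hz, ?_⟩
    rwa [closedNbhd_num hnum hL hz, Set.Dispenses.image_iff hnum.injOn (nbhd_subset hx)
      (nbhd_subset hy) (nbhd_subset hz)]

/-- A memory whose tables of edges are those of the input represents the hypergraph with the edges
that are still alive. -/
theorem represents_of_load (hnum : Set.BijOn num H.vertexSet {v | v < H.vertexSet.ncard})
    {G : Hypergraph α} (hG : G.vertexSet = H.vertexSet) {s : Mem}
    (hn : s.var .n = H.vertexSet.ncard) (hm : s.var .m = L.length)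
    (hsize : s.tab .size = (load H.vertexSet.ncard (L.map (List.map num))).tab .size)
    (hvert : s.tab .vert = (load H.vertexSet.ncard (L.map (List.map num))).tab .vert)
    (hE : ∀ e, e ∈ G.edgeSet ↔ ∃ p, ∃ hp : p < L.length, s.tab .alive p 0 = 1 ∧
      {v | v ∈ L[p]} = e) :
    s.Represents (G.image num) := by
  have hedge : ∀ p, ∀ hp : p < L.length, s.edge p = num '' {v | v ∈ L[p]} := by
    intro p hp
    ext q
    have := exists_getD_iff ((L.map (List.map num)).getD p []) q
    simp only [Mem.edge, hsize, hvert, load, if_true]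
    refine Iff.trans ?_ (this.trans ?_)
    · simp only [Set.mem_ofPred_eq, eq_comm (a := q)]
    · simp [hp]
  refine ⟨?_, ?_⟩
  · rw [hn, image_vertexSet, hG, hnum.image_eq]
  · ext e
    simp only [image_edgeSet, Set.mem_image, Set.mem_ofPred_eq, hm]
    constructor
    · rintro ⟨f, hf, rfl⟩
      obtain ⟨p, hp, ha, rfl⟩ := (hE f).1 hf
      exact ⟨p, hp, ha, hedge p hp⟩
    · rintro ⟨p, hp, ha, rfl⟩
      exact ⟨_, (hE _).2 ⟨p, hp, ha, rfl⟩, (hedge p hp).symm⟩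

theorem load_represents (hnum : Set.BijOn num H.vertexSet {v | v < H.vertexSet.ncard})
    (hL : H.IsListing L) :
    (load H.vertexSet.ncard (L.map (List.map num))).Represents (H.image num) := by
  refine represents_of_load (L := L) hnum rfl rfl (List.length_map _) rfl rfl fun e => ?_
  rw [hL.mem_edgeSet_iff]
  constructor
  · rintro ⟨l, hl, rfl⟩
    obtain ⟨p, hp, rfl⟩ := List.mem_iff_getElem.1 hl
    exact ⟨p, hp, by simp [load, hp], rfl⟩
  · rintro ⟨p, hp, -, rfl⟩
    exact ⟨_, List.getElem_mem hp, rfl⟩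

/-- For `x, y` in a common edge, adjacency is automatic, so `{x, y} ∈ D([H]₂)` reduces to the
existence of `z`, which is what dispensability of that edge of `H` requires. -/
theorem run_represents_skeleton (hnum : Set.BijOn num H.vertexSet {v | v < H.vertexSet.ncard})
    (hL : H.IsListing L) :
    (cartesianSkeletonAlgorithm.run
      (load H.vertexSet.ncard (L.map (List.map num)))).1.Represents (H.skeleton.image num) := by
  refine represents_of_load (G := H.skeleton) (L := L) hnum rfl
    (Cmd.run_var_of_not_writesVar rfl _)
    ((Cmd.run_var_of_not_writesVar rfl _).trans (List.length_map _))
    (Cmd.run_tab_of_not_writesTab (c := cartesianSkeletonAlgorithm) rfl _)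
    (Cmd.run_tab_of_not_writesTab (c := cartesianSkeletonAlgorithm) rfl _) fun e => ?_
  have halive : ∀ p, ∀ hp : p < L.length,
      (cartesianSkeletonAlgorithm.run
        (load H.vertexSet.ncard (L.map (List.map num)))).1.tab .alive p 0 = 1 ↔
      ¬ H.IsDispensable {v | v ∈ L[p]} := by
    intro p hp
    have hedge := hL.mem_edgeSet (List.getElem_mem hp)
    have hsub := H.subset_vertexSet_of_mem_edgeSet' hedge
    rw [(cartesianSkeletonAlgorithm_load _ _).1, isDispensable_iff,
      and_iff_right (by simpa using hp)]
    have hp' : (L.map (List.map num)).getD p [] = L[p].map num := by simp [hp]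
    rw [hp', not_iff_not]
    constructor
    · rintro ⟨x, hx, y, hy, h⟩
      obtain ⟨x, hx', rfl⟩ := List.mem_map.1 hx
      obtain ⟨y, hy', rfl⟩ := List.mem_map.1 hy
      rw [dispensablePair_num hnum hL (hsub hx') (hsub hy'),
        pair_mem_dispensableEdges_twoSection] at h
      exact ⟨x, hx', y, hy', h.1, h.2.2⟩
    · rintro ⟨x, hx, y, hy, hxy, h⟩
      refine ⟨num x, List.mem_map_of_mem hx, num y, List.mem_map_of_mem hy, ?_⟩
      rw [dispensablePair_num hnum hL (hsub hx) (hsub hy), pair_mem_dispensableEdges_twoSection]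
      exact ⟨hxy, ⟨_, hedge, hx, hy⟩, h⟩
  simp only [skeleton, Set.mem_sdiff, dispensableEdges, Set.mem_ofPred_eq, hL.mem_edgeSet_iff]
  constructor
  · rintro ⟨⟨l, hl, rfl⟩, h⟩
    obtain ⟨p, hp, rfl⟩ := List.mem_iff_getElem.1 hl
    exact ⟨p, hp, (halive p hp).2 fun h' => h ⟨⟨_, hl, rfl⟩, h'⟩, rfl⟩
  · rintro ⟨p, hp, h, rfl⟩
    exact ⟨⟨_, List.getElem_mem hp, rfl⟩, fun h' => (halive p hp).1 h h'.2⟩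

theorem run_cost_le (hV : H.vertexSet.Finite) (hs : H.IsSimple) (hc : H.IsConnected)
    (hL : H.IsListing L) :
    (cartesianSkeletonAlgorithm.run (load H.vertexSet.ncard (L.map (List.map num)))).2 ≤
      700 * max 1 (H.edgeSet.ncard ^ 2 * H.rank ^ 4) := by
  -- If there is an edge, the rank is positive because edges have at least two vertices; otherwise
  -- both sides vanish.
  have hle : H.edgeSet.ncard ≤ H.edgeSet.ncard * H.rank ∧
      H.edgeSet.ncard * H.rank ≤ H.edgeSet.ncard * H.rank ^ 2 := by
    refine ⟨?_, Nat.mul_le_mul_left _ (Nat.le_self_pow two_ne_zero _)⟩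
    rcases H.edgeSet.eq_empty_or_nonempty with h | ⟨e, he⟩
    · simp [h]
    · exact Nat.le_mul_of_pos_right _ ((zero_lt_two.trans_le (hs.2 e he)).trans_le
        (ncard_le_rank hV he))
  have hX : (max 1 (H.edgeSet.ncard * H.rank ^ 2)) ^ 2 ≤
      max 1 (H.edgeSet.ncard ^ 2 * H.rank ^ 4) := by
    rcases max_choice 1 (H.edgeSet.ncard * H.rank ^ 2) with h | h <;> rw [h]
    · simp
    · exact le_max_of_le_right (le_of_eq (by ring))
  refine (cartesianSkeletonAlgorithm_cost _ _ (r := H.rank)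
    (X := max 1 (H.edgeSet.ncard * H.rank ^ 2)) (fun l hl => ?_) (le_max_left _ _)
    ((ncard_vertexSet_le hV hs hc).trans (max_le_max_left _ hle.2)) ?_ ?_).trans
    (Nat.mul_le_mul_left _ hX)
  · obtain ⟨l, hl', rfl⟩ := List.mem_map.1 hl
    rw [List.length_map]
    exact hL.length_le_rank hV hl'
  · rw [List.length_map, hL.length_eq]
    exact le_max_of_le_right (hle.1.trans hle.2)
  · rw [List.length_map, hL.length_eq]
    exact le_max_right _ _

end SkeletonRAM

open SkeletonRAM in
theorem mainTheorem7 : ∃ C : ℕ, ∀ (α : Type*) (H : Hypergraph α),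
    H.vertexSet.Finite → H.IsSimple → H.IsConnected →
    -- any numbering of the vertices and any listing of the edges
    ∀ (num : α → ℕ), Set.BijOn num H.vertexSet {v | v < H.vertexSet.ncard} →
    ∀ (L : List (List α)), H.IsListing L →
    ∀ start : Mem, start = load H.vertexSet.ncard (L.map (List.map num)) →
      -- the input
      start.Represents (H.image num) ∧
      -- the first step computes the dispensable edges of the 2-section
      (∀ x ∈ H.vertexSet, ∀ y ∈ H.vertexSet,
        ((computeDispensable.run start).1.tab .disp (num x) (num y) = 1 ↔
          {x, y} ∈ H.twoSection.dispensableEdges)) ∧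
      -- the output is the Cartesian skeleton
      (cartesianSkeletonAlgorithm.run start).1.Represents (H.skeleton.image num) ∧
      -- the number of steps
      (cartesianSkeletonAlgorithm.run start).2 ≤
        C * max 1 (H.edgeSet.ncard ^ 2 * H.rank ^ 4) := by
  refine ⟨700, fun α H hV hs hc num hnum L hL start hstart => ?_⟩
  subst hstart
  exact ⟨load_represents hnum hL,
    fun x hx y hy => ((computeDispensable_load _ _).1 _ _).trans
      (dispensablePair_num hnum hL hx hy),
    run_represents_skeleton hnum hL, run_cost_le hV hs hc hL⟩
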